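/- For $d\ge 3$ let $T_d$ be the $d$-regular tree with a fixed labelling: a map $l$ from the edges to a set $\Omega$ of cardinality $d$ such that an edge and its reverse have the same label and, for every vertex $x$, $l$ restricts to a bijection from the set $E(x)$ of edges issuing from $x$ onto $\Omega$. The group $\mathrm{Aut}(T_d)$ carries the permutation topology (pointwise convergence on the discrete set of vertices). Let $B_{d,k}$ be a labelled ball of radius $k$ in $T_d$; for a vertex $x$ let $l_x^k\colon B(x,k)\to B_{d,k}$ be the label-respecting isomorphism, and for $g\in\mathrm{Aut}(T_d)$ let $\sigma_k(g,x)=l^k_{gx}\circ g\circ (l^k_x)^{-1}\in\mathrm{Aut}(B_{d,k})$. For $F\le\mathrm{Aut}(B_{d,k})$ put $\mathrm{U}_k(F)=\{g\in\mathrm{Aut}(T_d)\mid \sigma_k(g,x)\in F \text{ for all vertices } x\}$. Let $V_1\sqcup V_2$ be the regular bipartition of the vertex set; for $F\le\mathrm{Aut}(B_{d,2k})$ let $\mathrm{BU}_{2k}(F)$ be the group of all $g\in\mathrm{Aut}(T_d)$ that preserve the bipartition (that is, $gV_1=V_1$) and satisfy $\sigma_{2k}(g,x)\in F$ for all $x\in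 V_1$. For $H\le\mathrm{Aut}(T_d)$, the local action of $H$ at a vertex $x$ is the permutation group that the stabilizer $H_x$ induces on $E(x)$; $H$ is locally "X" if its local action at every vertex has property "X". A permutation group is quasiprimitive if it is transitive and each of its non-trivial normal subgroups is transitive, and semiprimitive if it is transitive and each of its normal subgroups is transitive or semiregular (has trivial point stabilizers). An element of $H$ is quasi-central if its centralizer in $H$ is open in $H$. For $g\in\mathrm{Aut}(T_d)$ let $l(g)=\min_x d(x,gx)$ and $V(g)=\{x\mid d(x,gx)=l(g)\}$, where $x$ ranges over the vertices. Then $g$ is elliptic if $l(g)=0$, hyperbolic of length $l(g)$ if $l(g)>0$ and $V(g)$ is infinite, and an inversion if $l(g)>0$ and $V(g)$ is finite; $g$ is edge-fixating if it fixes an edge together with both its end vertices. **Theorem.** For each of the following items there are $d\ge 3$ and a closed, non-discrete, compactly generated subgroup $H$ of $\mathrm{Aut}(T_d)$ which is locally - (i) intransitive and contains a quasi-central inversion; - (ii) transitive and contains a non-trivial quasi-central edge-fixating element; - (iii) semiprimitive and contains a non-trivial quasi-central elliptic element; - (iv)(a) intransitive and contains a quasi-central hyperbolic element of length $1$; - (iv)(b)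 quasiprimitive and contains a quasi-central hyperbolic element of length $2$. Moreover, in items (i), (ii), (iii) and (iv)(a) the group can be taken of the form $H=\bigcap_{k\ge 1}\mathrm{U}_k(F^{(k)})$ with subgroups $F^{(k)}\le\mathrm{Aut}(B_{d,k})$, and in item (iv)(b) of the form $H=\bigcap_{k\ge 1}\mathrm{BU}_{2k}(F^{(2k)})$ with subgroups $F^{(2k)}\le\mathrm{Aut}(B_{d,2k})$. -/

import Mathlib

open Monoid

/-! ### Automorphism groups of graphs -/

section Graphs

variable {V : Type*} (T : SimpleGraph V)

/-- The group of automorphisms of a graph, with composition as multiplication. -/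
abbrev GraphAut : Type _ := T ≃g T

variable {T}

/-- The permutation topology: the topology of pointwise convergence on the discrete vertex set.
(An edge of a simple graph is determined by its end vertices, so that acting on vertices and edges
gives the same topology.) -/
instance graphAutTopology : TopologicalSpace (GraphAut T) :=
  TopologicalSpace.induced (fun g : GraphAut T => (g : V → V))
    (@Pi.topologicalSpace V (fun _ => V) (fun _ => ⊥))

/-- The permutation group that the stabilizer of `x` in `H` induces on the set of edges issuing
from `x`; the edge from `x` to `y` is represented by the neighbour `y` of `x`. -/
def localAction (H : Subgroup (GraphAut T)) (x : V) : Subgroup (Equiv.Perm (T.neighborSet x)) where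
  carrier := {p | ∃ g ∈ H, g x = x ∧ ∀ y : T.neighborSet x, ((p y : T.neighborSet x) : V) = g y}
  one_mem' := ⟨1, H.one_mem, rfl, fun _ => rfl⟩
  mul_mem' := by
    rintro p q ⟨g, hg, hgx, hp⟩ ⟨h, hh, hhx, hq⟩
    refine ⟨g * h, H.mul_mem hg hh, ?_, fun y => ?_⟩
    · rw [RelIso.mul_apply, hhx, hgx]
    · rw [Equiv.Perm.mul_apply, hp, hq, RelIso.mul_apply]
  inv_mem' := by
    rintro p ⟨g, hg, hgx, hp⟩
    refine ⟨g⁻¹, H.inv_mem hg, ?_, fun y => ?_⟩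
    · conv_lhs => rw [← hgx]
      exact RelIso.inv_apply_self g x
    · have h := hp (p⁻¹ y)
      rw [show p (p⁻¹ y) = y from p.apply_symm_apply y] at h
      rw [h]
      exact (RelIso.inv_apply_self g _).symm

/-- A permutation group is semiregular if its point stabilizers are trivial. -/
def IsSemiregularPerm {X : Type*} (N : Subgroup (Equiv.Perm X)) : Prop :=
  ∀ σ ∈ N, ∀ x : X, σ x = x → σ = 1

/-- A permutation group is semiprimitive if it is transitive and all its normal subgroups are
transitive or semiregular. -/
def IsSemiprimitivePerm {X : Type*} (P : Subgroup (Equiv.Perm X)) : Prop :=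
  MulAction.IsPretransitive P X ∧
    ∀ N : Subgroup (Equiv.Perm X), N ≤ P → (N.subgroupOf P).Normal →
      MulAction.IsPretransitive N X ∨ IsSemiregularPerm N

/-- A permutation group is quasiprimitive if it is transitive and all its non-trivial normal
subgroups are transitive. -/
def IsQuasiprimitivePerm {X : Type*} (P : Subgroup (Equiv.Perm X)) : Prop :=
  MulAction.IsPretransitive P X ∧
    ∀ N : Subgroup (Equiv.Perm X), N ≤ P → (N.subgroupOf P).Normal → N ≠ ⊥ →
      MulAction.IsPretransitive N X

def LocallyTransitive (H : Subgroup (GraphAut T)) : Prop :=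
  ∀ x : V, MulAction.IsPretransitive (localAction H x) (T.neighborSet x)

def LocallyIntransitive (H : Subgroup (GraphAut T)) : Prop :=
  ∀ x : V, ¬ MulAction.IsPretransitive (localAction H x) (T.neighborSet x)

def LocallySemiprimitive (H : Subgroup (GraphAut T)) : Prop :=
  ∀ x : V, IsSemiprimitivePerm (localAction H x)

def LocallyQuasiprimitive (H : Subgroup (GraphAut T)) : Prop :=
  ∀ x : V, IsQuasiprimitivePerm (localAction H x)

/-! ### Types of automorphisms of a tree -/

/-- `l(g)`, the minimum of `d(x, g x)` over all vertices `x`. -/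
noncomputable def translationLength (g : GraphAut T) : ℕ :=
  sInf (Set.range fun x : V => T.dist x (g x))

/-- `V(g)`, the set of vertices `x` with `d(x, g x) = l(g)`. -/
def minimalSet (g : GraphAut T) : Set V :=
  {x | T.dist x (g x) = translationLength g}

def IsElliptic (g : GraphAut T) : Prop :=
  translationLength g = 0

def IsHyperbolic (g : GraphAut T) : Prop :=
  0 < translationLength g ∧ (minimalSet g).Infinite

def IsInversion (g : GraphAut T) : Prop :=
  0 < translationLength g ∧ (minimalSet g).Finite

/-- `g` fixes an (oriented) edge. -/
def IsEdgeFixating (g : GraphAut T) : Prop :=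
  ∃ x y : V, T.Adj x y ∧ g x = x ∧ g y = y

end Graphs

/-! ### Topological groups -/

/-- The quasi-center: the elements whose centralizer is open. -/
def quasiCenter (G : Type*) [Group G] [TopologicalSpace G] : Set G :=
  {h | IsOpen (Subgroup.centralizer {h} : Set G)}

def IsCompactlyGeneratedGroup (G : Type*) [Group G] [TopologicalSpace G] : Prop :=
  ∃ K : Set G, IsCompact K ∧ Subgroup.closure K = ⊤

/-- A closed, non-discrete, compactly generated subgroup of the automorphism group. -/
def IsClosedNondiscreteCompGen {V : Type*} {T : SimpleGraph V}
    (H : Subgroup (GraphAut T)) : Prop :=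
  IsClosed (H : Set (GraphAut T)) ∧ ¬ DiscreteTopology H ∧ IsCompactlyGeneratedGroup H

/-! ### The labelled `d`-regular tree

The vertices are the elements of the free product of `d` groups of order two, with the set of
labels `Fin d`; the edge of label `ω` issuing from the vertex `x` leads to `x * treeGen ω`. -/

/-- The vertex set of the `d`-regular tree. -/
abbrev TreeVertex (d : ℕ) : Type := CoprodI (fun _ : Fin d => Multiplicative (ZMod 2))

/-- The generator of the free factor with index `ω`. -/
def treeGen {d : ℕ} (ω : Fin d) : TreeVertex d :=
  CoprodI.of (M := fun _ : Fin d => Multiplicative (ZMod 2)) (i := ω) (Multiplicative.ofAdd 1)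

theorem treeGen_mul_self {d : ℕ} (ω : Fin d) : treeGen ω * treeGen ω = 1 := by
  have h : (Multiplicative.ofAdd (1 : ZMod 2)) * Multiplicative.ofAdd 1 = 1 := by decide
  rw [treeGen, ← map_mul, h, map_one]

theorem treeGen_inv {d : ℕ} (ω : Fin d) : (treeGen ω)⁻¹ = treeGen ω :=
  inv_eq_of_mul_eq_one_right (treeGen_mul_self ω)

theorem treeGen_ne_one {d : ℕ} (ω : Fin d) : treeGen ω ≠ 1 := by
  intro h
  have h2 : (Multiplicative.ofAdd (1 : ZMod 2)) = 1 :=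
    CoprodI.of_injective (M := fun _ : Fin d => Multiplicative (ZMod 2)) ω
      (h.trans (map_one _).symm)
  exact absurd h2 (by decide)

/-- The `d`-regular tree `T_d`. -/
def regularTree (d : ℕ) : SimpleGraph (TreeVertex d) where
  Adj x y := ∃ ω : Fin d, y = x * treeGen ω
  symm := ⟨by
    rintro x y ⟨ω, rfl⟩
    exact ⟨ω, by rw [mul_assoc, treeGen_mul_self, mul_one]⟩⟩
  loopless := ⟨by
    rintro x ⟨ω, h⟩
    exact treeGen_ne_one ω (left_eq_mul.mp h)⟩

/-- The length of the reduced word of `x⁻¹`, which is that of `x`. -/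
def wordLength {d : ℕ} (x : TreeVertex d) : ℕ := (CoprodI.Word.equiv x⁻¹).toList.length

theorem word_smul_cases {d : ℕ} (ω : Fin d)
    (w : CoprodI.Word (fun _ : Fin d => Multiplicative (ZMod 2))) :
    (w.fstIdx = some ω ∧ (treeGen ω • w).toList.length + 1 = w.toList.length) ∨
      (w.fstIdx ≠ some ω ∧ (treeGen ω • w).toList.length = w.toList.length + 1) := by
  have key : ∀ m : Multiplicative (ZMod 2), m ≠ 1 → m = Multiplicative.ofAdd 1 := by decide
  have hne : (Multiplicative.ofAdd (1 : ZMod 2)) ≠ 1 := by decide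
  have hcons : ∀ (u : CoprodI.Word (fun _ : Fin d => Multiplicative (ZMod 2)))
      (hu : u.fstIdx ≠ some ω), treeGen ω • u =
        CoprodI.Word.cons (M := fun _ : Fin d => Multiplicative (ZMod 2)) (i := ω)
          (Multiplicative.ofAdd (1 : ZMod 2)) u hu hne := by
    intro u hu
    rw [CoprodI.Word.cons_eq_smul]
    rfl
  by_cases h : w.fstIdx = some ω
  · left
    refine ⟨h, ?_⟩
    induction w using CoprodI.Word.consRecOn with
    | empty => simp [CoprodI.Word.fstIdx, CoprodI.Word.empty] at h
    | cons i m u h1 h2 _ =>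
      rw [CoprodI.Word.fstIdx_cons, Option.some_inj] at h
      subst h
      obtain rfl := key m h2
      rw [← hcons u h1, smul_smul, treeGen_mul_self, one_smul, hcons u h1]
      rfl
  · exact Or.inr ⟨h, by rw [hcons w h]; rfl⟩

theorem wordLength_mul_cases {d : ℕ} (x : TreeVertex d) (ω : Fin d) :
    ((CoprodI.Word.equiv x⁻¹).fstIdx = some ω ∧ wordLength (x * treeGen ω) + 1 = wordLength x) ∨
      ((CoprodI.Word.equiv x⁻¹).fstIdx ≠ some ω ∧
        wordLength (x * treeGen ω) = wordLength x + 1) := by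
  have h : CoprodI.Word.equiv (x * treeGen ω)⁻¹ = treeGen ω • CoprodI.Word.equiv x⁻¹ := by
    rw [mul_inv_rev, treeGen_inv]
    exact mul_smul (treeGen ω) x⁻¹
      (CoprodI.Word.empty : CoprodI.Word (fun _ : Fin d => Multiplicative (ZMod 2)))
  unfold wordLength
  rw [h]
  exact word_smul_cases ω _

theorem treeGen_injective (d : ℕ) : Function.Injective (treeGen (d := d)) := by
  intro a b h
  by_contra hab
  have h1 := wordLength_mul_cases (treeGen a) a
  have h2 := wordLength_mul_cases (treeGen a) b
  have h3 := wordLength_mul_cases (treeGen b) b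
  rw [← h] at h3
  have e1 : wordLength (1 : TreeVertex d) = 0 := by simp [wordLength]; rfl
  rw [treeGen_mul_self, e1] at h1
  rw [show treeGen a * treeGen b = 1 by rw [← h, treeGen_mul_self], e1] at h2
  rcases h1 with ⟨h1, _⟩ | ⟨_, h1⟩
  · rcases h2 with ⟨h2, _⟩ | ⟨_, h2⟩
    · exact hab (Option.some_inj.mp (h1.symm.trans h2))
    · omega
  · omega

/-- Every vertex of `regularTree d` has exactly `d` neighbours, one for each label. -/
noncomputable def neighborEquiv (d : ℕ) (x : TreeVertex d) :
    Fin d ≃ (regularTree d).neighborSet x :=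
  Equiv.ofBijective (fun ω => ⟨x * treeGen ω, ω, rfl⟩)
    ⟨fun _ _ h => treeGen_injective d (mul_left_cancel (Subtype.ext_iff.mp h)),
      fun ⟨_, ω, h⟩ => ⟨ω, Subtype.ext h.symm⟩⟩

theorem regularTree_connected (d : ℕ) : (regularTree d).Connected := by
  have key : ∀ x y : TreeVertex d, (regularTree d).Reachable y (y * x) := by
    intro x
    induction x using CoprodI.induction_on with
    | one => intro y; rw [mul_one]
    | of i m =>
      intro y
      have hm : m = 1 ∨ m = Multiplicative.ofAdd 1 := by revert m; decide
      rcases hm with rfl | rfl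
      · rw [map_one, mul_one]
      · exact SimpleGraph.Adj.reachable ⟨i, rfl⟩
    | mul a b ha hb =>
      intro y
      rw [← mul_assoc]
      exact (ha y).trans (hb _)
  refine ⟨fun x y => ?_⟩
  have := key (x⁻¹ * y) x
  rwa [mul_inv_cancel_left] at this

theorem regularTree_isTree (d : ℕ) : (regularTree d).IsTree := by
  refine ⟨regularTree_connected d, fun u c hc => ?_⟩
  obtain ⟨v, hv, hmax⟩ : ∃ v ∈ c.support, ∀ z ∈ c.support, wordLength z ≤ wordLength v := by
    obtain ⟨v, hv, h⟩ := c.support.toFinset.exists_max_image wordLength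
      ⟨u, by simp⟩
    exact ⟨v, by simpa using hv, fun z hz => h z (by simpa using hz)⟩
  have hr := hc.rotate hv
  have hnil := hr.not_nil
  have hlow : ∀ z, (regularTree d).Adj v z → z ∈ (c.rotate v hv).support →
      ∃ ω, z = v * treeGen ω ∧ (CoprodI.Word.equiv v⁻¹).fstIdx = some ω := by
    rintro z ⟨ω, rfl⟩ hz
    have := hmax _ ((SimpleGraph.Walk.mem_support_rotate_iff c v hv).mp hz)
    rcases wordLength_mul_cases v ω with ⟨h, _⟩ | ⟨_, h⟩
    · exact ⟨ω, rfl, h⟩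
    · omega
  obtain ⟨a, ha, ha'⟩ := hlow _ ((c.rotate v hv).adj_snd hnil)
    (SimpleGraph.Walk.getVert_mem_support _ _)
  obtain ⟨b, hb, hb'⟩ := hlow _ ((c.rotate v hv).adj_penultimate hnil).symm
    (SimpleGraph.Walk.getVert_mem_support _ _)
  refine hr.snd_ne_penultimate ?_
  rw [ha, hb, Option.some_inj.mp (ha'.symm.trans hb')]

/-! ### Local actions on balls and generalized universal groups -/

/-- The unique label-respecting automorphism of the tree that maps `x` to the base vertex `1`. -/
def labelAut {d : ℕ} (x : TreeVertex d) : GraphAut (regularTree d) where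
  toEquiv := Equiv.mulLeft x⁻¹
  map_rel_iff' := by
    intro a b
    refine exists_congr fun ω => ?_
    rw [Equiv.coe_mulLeft, mul_assoc]
    exact mul_right_inj _

theorem labelAut_self {d : ℕ} (x : TreeVertex d) : labelAut x x = 1 := inv_mul_cancel x

theorem labelAut_inv_one {d : ℕ} (x : TreeVertex d) : (labelAut x)⁻¹ 1 = x := by
  rw [← labelAut_self x]
  exact RelIso.inv_apply_self _ _

/-- `labelAut x` respects labels. -/
theorem labelAut_label {d : ℕ} (x y : TreeVertex d) (ω : Fin d) :
    labelAut x (y * treeGen ω) = labelAut x y * treeGen ω := (mul_assoc _ _ _).symm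

/-- The ball of radius `k` around the base vertex. -/
def ballSet (d k : ℕ) : Set (TreeVertex d) := {v | (regularTree d).dist 1 v ≤ k}

/-- `B_{d,k}`, the ball of radius `k` around the base vertex, as a tree. -/
abbrev ballTree (d k : ℕ) : SimpleGraph (ballSet d k) := (regularTree d).induce (ballSet d k)

theorem dist_le_of_aut {d : ℕ} (g : GraphAut (regularTree d)) (x y : TreeVertex d) :
    (regularTree d).dist (g x) (g y) ≤ (regularTree d).dist x y := by
  obtain ⟨p, hp⟩ := (regularTree_connected d).exists_walk_length_eq_dist x y
  rw [← hp, ← SimpleGraph.Walk.length_map g.toHom p]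
  exact SimpleGraph.dist_le _

theorem aut_mem_ballSet {d k : ℕ} {g : GraphAut (regularTree d)} (hg : g 1 = 1)
    {v : TreeVertex d} (hv : v ∈ ballSet d k) : g v ∈ ballSet d k := by
  have h := dist_le_of_aut g 1 v
  rw [hg] at h
  exact h.trans hv

theorem aut_inv_one {d : ℕ} {g : GraphAut (regularTree d)} (hg : g 1 = 1) : g⁻¹ 1 = 1 := by
  conv_lhs => rw [← hg]
  exact RelIso.inv_apply_self g 1

/-- The restriction to `B_{d,k}` of an automorphism of the tree that fixes the base vertex. -/
def restrictBall {d : ℕ} (k : ℕ) (g : GraphAut (regularTree d)) (hg : g 1 = 1) :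
    GraphAut (ballTree d k) where
  toFun v := ⟨g v.1, aut_mem_ballSet hg v.2⟩
  invFun v := ⟨g⁻¹ v.1, aut_mem_ballSet (aut_inv_one hg) v.2⟩
  left_inv _ := Subtype.ext (RelIso.inv_apply_self g _)
  right_inv _ := Subtype.ext (RelIso.apply_inv_self g _)
  map_rel_iff' := g.map_rel_iff'

/-- `l_{gx} ∘ g ∘ l_x⁻¹` as an automorphism of the whole tree; it fixes the base vertex. -/
def localAut {d : ℕ} (g : GraphAut (regularTree d)) (x : TreeVertex d) :
    GraphAut (regularTree d) :=
  labelAut (g x) * g * (labelAut x)⁻¹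

theorem localAut_one {d : ℕ} (g : GraphAut (regularTree d)) (x : TreeVertex d) :
    localAut g x 1 = 1 := by
  rw [localAut, RelIso.mul_apply, RelIso.mul_apply, labelAut_inv_one, labelAut_self]

/-- The `k`-local action `σ_k(g, x) = l_{gx}^k ∘ g ∘ (l_x^k)⁻¹` of `g` at the vertex `x`, where
`l_x^k` is the label-respecting isomorphism from the ball of radius `k` around `x` to `B_{d,k}`. -/
def sigma {d : ℕ} (k : ℕ) (g : GraphAut (regularTree d)) (x : TreeVertex d) :
    GraphAut (ballTree d k) :=
  restrictBall k (localAut g x) (localAut_one g x)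

/-- The cocycle identity. -/
theorem sigma_mul {d : ℕ} (k : ℕ) (g h : GraphAut (regularTree d)) (x : TreeVertex d) :
    sigma k (g * h) x = sigma k g (h x) * sigma k h x := by
  have e : localAut (g * h) x = localAut g (h x) * localAut h x := by
    unfold localAut
    rw [RelIso.mul_apply]
    group
  ext v
  change localAut (g * h) x v = localAut g (h x) (localAut h x v)
  rw [e, RelIso.mul_apply]

theorem sigma_one {d : ℕ} (k : ℕ) (x : TreeVertex d) : sigma k 1 x = 1 := by
  have h := sigma_mul k 1 1 x
  rw [one_mul, RelIso.one_apply] at h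
  exact left_eq_mul.mp h

theorem sigma_inv {d : ℕ} (k : ℕ) (g : GraphAut (regularTree d)) (x : TreeVertex d) :
    sigma k g⁻¹ x = (sigma k g (g⁻¹ x))⁻¹ := by
  have h := sigma_mul k g g⁻¹ x
  rw [mul_inv_cancel, sigma_one] at h
  exact eq_inv_of_mul_eq_one_right h.symm

/-- The generalized universal group `U_k(F)`: the automorphisms of the tree all of whose `k`-local
actions belong to `F`. -/
def universalGroup {d : ℕ} (k : ℕ) (F : Subgroup (GraphAut (ballTree d k))) :
    Subgroup (GraphAut (regularTree d)) where
  carrier := {g | ∀ x, sigma k g x ∈ F}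
  one_mem' x := by rw [sigma_one]; exact F.one_mem
  mul_mem' hg hh x := by rw [sigma_mul]; exact F.mul_mem (hg _) (hh _)
  inv_mem' hg x := by rw [sigma_inv]; exact F.inv_mem (hg _)

/-- The class `V_1` of the regular bipartition of the tree: the vertices at even distance from the
base vertex. -/
def evenVertices (d : ℕ) : Set (TreeVertex d) := {x | Even ((regularTree d).dist 1 x)}

/-- The group of automorphisms of the tree that preserve the bipartition. -/
def bipartiteAut (d : ℕ) : Subgroup (GraphAut (regularTree d)) where
  carrier := {g | ∀ x, g x ∈ evenVertices d ↔ x ∈ evenVertices d}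
  one_mem' _ := Iff.rfl
  mul_mem' hg hh x := (hg _).trans (hh x)
  inv_mem' {g} hg x := by
    have h := hg (g⁻¹ x)
    rw [RelIso.apply_inv_self] at h
    exact h.symm

/-- The bipartite generalized universal group `BU_k(F)` (used for even `k`): the automorphisms of
the tree that preserve the bipartition and whose `k`-local actions at the vertices in `V_1` belong
to `F`. -/
def bipartiteUniversalGroup {d : ℕ} (k : ℕ) (F : Subgroup (GraphAut (ballTree d k))) :
    Subgroup (GraphAut (regularTree d)) where
  carrier := {g | g ∈ bipartiteAut d ∧ ∀ x ∈ evenVertices d, sigma k g x ∈ F}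
  one_mem' := ⟨one_mem _, fun x _ => by rw [sigma_one]; exact F.one_mem⟩
  mul_mem' hg hh := ⟨mul_mem hg.1 hh.1, fun x hx => by
    rw [sigma_mul]; exact F.mul_mem (hg.2 _ ((hh.1 x).mpr hx)) (hh.2 x hx)⟩
  inv_mem' {g} hg := ⟨inv_mem hg.1, fun x hx => by
    rw [sigma_inv]; exact F.inv_mem (hg.2 _ ((inv_mem hg.1 x).mpr hx))⟩

/-- `H` is the intersection over all `k ≥ 1` of groups `U_k(F_k)`, with `F_k ≤ Aut(B_{d,k})`. -/
def IsUniversalIntersection {d : ℕ} (H : Subgroup (GraphAut (regularTree d))) : Prop :=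
  ∃ F : (k : ℕ) → Subgroup (GraphAut (ballTree d k)),
    H = ⨅ (k : ℕ) (_ : 1 ≤ k), universalGroup k (F k)

/-- `H` is the intersection over all `k ≥ 1` of groups `BU_{2k}(F_k)`, with
`F_k ≤ Aut(B_{d,2k})`. -/
def IsBipartiteUniversalIntersection {d : ℕ} (H : Subgroup (GraphAut (regularTree d))) : Prop :=
  ∃ F : (k : ℕ) → Subgroup (GraphAut (ballTree d (2 * k))),
    H = ⨅ (k : ℕ) (_ : 1 ≤ k), bipartiteUniversalGroup (2 * k) (F k)

/-! ### The free product of groups of order two -/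

/-! All five groups come from one construction. Vertices are words in the involutions `treeGen a`,
and a partial map `rep` on labels induces an endomorphism `proj` of this free product, which deletes
some letters and identifies others. `FiberDatum.group` consists of the automorphisms that permute
the fibres of `proj`, have local permutations in a given group F, constant on each fibre, and act by
conjugation on an auxiliary group N, normalized by F, in the same way at every vertex.

Quasi-centrality (`IsStabilizerFull.mem_quasiCenter`): let h have constant local permutation n in N,
where n preserves `rep`, and let h move 1 within its fibre. Then h preserves every fibre. If g in
the group fixes 1, its neighbours and h 1, then its local permutation at 1 is trivial, so all its
local permutations commute with n; being constant on fibres, they agree at x and h x. Hence gh and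
hg agree at 1 and have equal local permutations, so gh = hg.

Non-discreteness (`IsStabilizerFull.not_discreteTopology`): by `exists_mem_group`, suitably
compatible families of local permutations, pulled back along `proj`, are realized in the group. If f
≠ 1 in F commutes with N and fixes every label represented by i₀, then f may be used beyond a given
depth and 1 elsewhere, where depth changes across i₀-edges only. This gives non-trivial elements
fixing arbitrarily large balls.

The defining conditions involve finitely many vertices at a time, so the group is closed. It
contains all label-respecting automorphisms; this yields compact generation, the local action F at
every vertex, and the form of an intersection of universal groups, with F^(k) the restriction of the
stabilizer of 1 to the k-ball.

It remains to choose data. Deleting a label a makes left multiplication by `treeGen a` a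
quasi-central inversion; deleting two labels does the same for a translation of length 1 whose local
permutations swap them. Pairing four labels gives an edge-fixating element that swaps one pair
everywhere. If a permutation τ centralizes F, its cycles may be identified: SL(2,3) on 8 cosets with
τ = -1 gives the elliptic element, and A₅ on ordered pairs of distinct points with τ exchanging
coordinates gives the translation of length 2. -/

theorem perm_apply_inv {X : Type*} (f : Equiv.Perm X) (x : X) : f (f⁻¹ x) = x :=
  f.apply_symm_apply x

theorem perm_inv_apply {X : Type*} (f : Equiv.Perm X) (x : X) : f⁻¹ (f x) = x :=
  f.symm_apply_apply x

theorem treeVertex_induction {d : ℕ} {P : TreeVertex d → Prop} (one : P 1)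
    (mul_gen : ∀ x a, P x → P (x * treeGen a)) (x : TreeVertex d) : P x := by
  have key : ∀ x y : TreeVertex d, P y → P (y * x) := by
    intro x
    induction x using CoprodI.induction_on with
    | one => intro y hy; rwa [mul_one]
    | of i m =>
      intro y hy
      have hm : m = 1 ∨ m = Multiplicative.ofAdd 1 := by revert m; decide
      rcases hm with rfl | rfl
      · rwa [map_one, mul_one]
      · exact mul_gen y i hy
    | mul a b ha hb =>
      intro y hy
      rw [← mul_assoc]
      exact hb _ (ha y hy)
  simpa using key x 1 one

theorem mul_treeGen_treeGen {d : ℕ} (x : TreeVertex d) (a : Fin d) :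
    x * treeGen a * treeGen a = x := by
  rw [mul_assoc, treeGen_mul_self, mul_one]

/-- The homomorphism from the group of order two given by an involution. -/
def involutionHom {M : Type*} [Monoid M] (m : M) (hm : m * m = 1) :
    Multiplicative (ZMod 2) →* M where
  toFun z := if z = 1 then 1 else m
  map_one' := if_pos rfl
  map_mul' z w := by
    have hz : ∀ z : Multiplicative (ZMod 2), z = 1 ∨ z = Multiplicative.ofAdd 1 := by decide
    have h1 : (Multiplicative.ofAdd (1 : ZMod 2)) ≠ 1 := by decide
    have h2 : (Multiplicative.ofAdd (1 : ZMod 2)) * Multiplicative.ofAdd 1 = 1 := by decide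
    rcases hz z with rfl | rfl <;> rcases hz w with rfl | rfl <;> simp [h1, h2, hm]

/-- The homomorphism given by involutions, one for each label. -/
def treeLift {d : ℕ} {M : Type*} [Monoid M] (m : Fin d → M) (hm : ∀ a, m a * m a = 1) :
    TreeVertex d →* M :=
  CoprodI.lift fun a => involutionHom (m a) (hm a)

@[simp] theorem treeLift_treeGen {d : ℕ} {M : Type*} [Monoid M] (m : Fin d → M)
    (hm : ∀ a, m a * m a = 1) (a : Fin d) : treeLift m hm (treeGen a) = m a := by
  have h1 : (Multiplicative.ofAdd (1 : ZMod 2)) ≠ 1 := by decide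
  rw [treeLift, treeGen, CoprodI.lift_of]
  simp [involutionHom, h1]

/-- Functions on the vertices of the tree may be defined by recursion along edges, provided that
every step is undone by the step along the reverse edge. -/
theorem exists_treeRec {d : ℕ} {X : Type*} (x₀ : X) (step : Fin d → X → X)
    (hstep : ∀ a x, step a (step a x) = x) :
    ∃ φ : TreeVertex d → X, φ 1 = x₀ ∧ ∀ x a, φ (x * treeGen a) = step a (φ x) := by
  have hinv : ∀ a, Function.Involutive.toPerm (step a) (hstep a) *
      Function.Involutive.toPerm (step a) (hstep a) = 1 := fun a => Equiv.ext fun x => hstep a x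
  -- The inverse makes the generator appended last act last.
  refine ⟨fun x => treeLift (fun a => Function.Involutive.toPerm (step a) (hstep a)) hinv x⁻¹ x₀,
    by simp, fun x a => ?_⟩
  simp only [mul_inv_rev, treeGen_inv, map_mul, treeLift_treeGen, Equiv.Perm.mul_apply]
  rfl

/-! ### Parity -/

/-- The sign homomorphism, for which all the generators are odd. -/
def treeParity (d : ℕ) : TreeVertex d →* Multiplicative (ZMod 2) :=
  treeLift (fun _ => Multiplicative.ofAdd 1) fun _ => by decide

@[simp] theorem treeParity_treeGen {d : ℕ} (a : Fin d) :
    treeParity d (treeGen a) = Multiplicative.ofAdd 1 := treeLift_treeGen _ _ _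

theorem treeParity_walk {d : ℕ} {x y : TreeVertex d} (w : (regularTree d).Walk x y) :
    treeParity d x = treeParity d y ↔ Even w.length := by
  induction w with
  | nil => simp
  | @cons u v w h q ih =>
    rw [SimpleGraph.Walk.length_cons, Nat.even_add_one, ← ih]
    obtain ⟨a, rfl⟩ := h
    rw [map_mul, treeParity_treeGen]
    generalize treeParity d u = i
    generalize treeParity d w = j
    revert i j
    decide

theorem even_dist_iff {d : ℕ} (x y : TreeVertex d) :
    Even ((regularTree d).dist x y) ↔ treeParity d x = treeParity d y := by
  obtain ⟨p, hp⟩ := (regularTree_connected d).exists_walk_length_eq_dist x y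
  rw [← hp, treeParity_walk p]

theorem mem_evenVertices_iff {d : ℕ} (x : TreeVertex d) :
    x ∈ evenVertices d ↔ treeParity d x = 1 := by
  change Even _ ↔ _
  rw [even_dist_iff, map_one, eq_comm]

theorem dist_aut {d : ℕ} (g : GraphAut (regularTree d)) (x y : TreeVertex d) :
    (regularTree d).dist (g x) (g y) = (regularTree d).dist x y := by
  refine (dist_le_of_aut g x y).antisymm ?_
  have h := dist_le_of_aut g⁻¹ (g x) (g y)
  rwa [RelIso.inv_apply_self, RelIso.inv_apply_self] at h

theorem treeParity_aut {d : ℕ} (g : GraphAut (regularTree d)) (x y : TreeVertex d) :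
    treeParity d (g x) = treeParity d (g y) ↔ treeParity d x = treeParity d y := by
  rw [← even_dist_iff, dist_aut, even_dist_iff]

/-- Automorphisms respect equality of parity, so whether the two classes are exchanged can be read
off at a single vertex. -/
theorem mem_bipartiteAut_of_treeParity {d : ℕ} {g : GraphAut (regularTree d)} {x : TreeVertex d}
    (h : treeParity d (g x) = treeParity d x) : g ∈ bipartiteAut d := by
  intro y
  rw [mem_evenVertices_iff, mem_evenVertices_iff]
  have key := treeParity_aut g x y
  rw [h] at key
  revert key
  generalize treeParity d x = i
  generalize treeParity d y = j
  generalize treeParity d (g y) = k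
  revert i j k
  decide

/-! ### Local permutations -/

/-- The permutation of the labels by which `g` acts on the edges issuing from `x`. -/
noncomputable def locPerm {d : ℕ} (g : GraphAut (regularTree d)) (x : TreeVertex d) :
    Equiv.Perm (Fin d) :=
  (neighborEquiv d x).trans ((SimpleGraph.Iso.mapNeighborSet g x).trans
    (neighborEquiv d (g x)).symm)

theorem apply_mul_treeGen {d : ℕ} (g : GraphAut (regularTree d)) (x : TreeVertex d) (a : Fin d) :
    g (x * treeGen a) = g x * treeGen (locPerm g x a) := by
  have h : neighborEquiv d (g x) (locPerm g x a) =
      SimpleGraph.Iso.mapNeighborSet g x (neighborEquiv d x a) := Equiv.apply_symm_apply _ _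
  exact (Subtype.ext_iff.mp h).symm

theorem locPerm_eq_iff {d : ℕ} {g : GraphAut (regularTree d)} {x : TreeVertex d}
    {f : Equiv.Perm (Fin d)} :
    locPerm g x = f ↔ ∀ a, g (x * treeGen a) = g x * treeGen (f a) := by
  refine ⟨by rintro rfl a; exact apply_mul_treeGen g x a, fun h => Equiv.ext fun a => ?_⟩
  have := h a
  rw [apply_mul_treeGen] at this
  exact treeGen_injective d (mul_left_cancel this)

theorem locPerm_mul {d : ℕ} (g h : GraphAut (regularTree d)) (x : TreeVertex d) :
    locPerm (g * h) x = locPerm g (h x) * locPerm h x := by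
  rw [locPerm_eq_iff]
  intro a
  rw [RelIso.mul_apply, RelIso.mul_apply, apply_mul_treeGen, apply_mul_treeGen,
    Equiv.Perm.mul_apply]

@[simp] theorem locPerm_one {d : ℕ} (x : TreeVertex d) : locPerm 1 x = 1 := by
  rw [locPerm_eq_iff]
  intro a
  rfl

theorem locPerm_inv {d : ℕ} (g : GraphAut (regularTree d)) (x : TreeVertex d) :
    locPerm g⁻¹ x = (locPerm g (g⁻¹ x))⁻¹ := by
  have h := locPerm_mul g g⁻¹ x
  rw [mul_inv_cancel, locPerm_one] at h
  exact eq_inv_of_mul_eq_one_right h.symm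

theorem labelAut_apply {d : ℕ} (x y : TreeVertex d) : labelAut x y = x⁻¹ * y := rfl

@[simp] theorem locPerm_labelAut {d : ℕ} (x y : TreeVertex d) : locPerm (labelAut x) y = 1 := by
  rw [locPerm_eq_iff]
  exact fun a => labelAut_label x y a

theorem labelAut_mul {d : ℕ} (x y : TreeVertex d) : labelAut (x * y) = labelAut y * labelAut x := by
  ext z
  simp only [RelIso.mul_apply, labelAut_apply]
  group

@[simp] theorem labelAut_one {d : ℕ} : labelAut (1 : TreeVertex d) = 1 := by
  ext z
  simp [labelAut_apply]

theorem labelAut_inv {d : ℕ} (x : TreeVertex d) : labelAut x⁻¹ = (labelAut x)⁻¹ := by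
  rw [eq_inv_iff_mul_eq_one, ← labelAut_mul, mul_inv_cancel, labelAut_one]

/-- Automorphisms are determined by their local permutations and the image of a vertex. -/
theorem aut_ext {d : ℕ} {g h : GraphAut (regularTree d)} (h1 : g 1 = h 1)
    (hσ : ∀ x, locPerm g x = locPerm h x) : g = h := by
  ext x
  induction x using treeVertex_induction with
  | one => exact h1
  | mul_gen x a ih => rw [apply_mul_treeGen, apply_mul_treeGen, ih, hσ]

/-- Every compatible family of permutations is the family of local permutations of an automorphism
that fixes the base vertex. -/
theorem exists_aut_locPerm {d : ℕ} (σ : TreeVertex d → Equiv.Perm (Fin d))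
    (hσ : ∀ x a, σ (x * treeGen a) a = σ x a) :
    ∃ g : GraphAut (regularTree d), g 1 = 1 ∧ ∀ x, locPerm g x = σ x := by
  -- The step depends on the current vertex, so the recursion carries it as first coordinate.
  -- Compatibility of σ along an edge is what makes each step undo itself.
  obtain ⟨φ, hφ1, hφ⟩ := exists_treeRec ((1, 1) : TreeVertex d × TreeVertex d)
    (fun a x => (x.1 * treeGen a, x.2 * treeGen (σ x.1 a)))
    (fun a x => by simp only [hσ, mul_treeGen_treeGen])
  -- The inverse map: follow a path in the image and read each label back through σ at the preimage
  -- reached so far.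
  obtain ⟨ψ, hψ1, hψ⟩ := exists_treeRec (1 : TreeVertex d)
    (fun b x => x * treeGen ((σ x)⁻¹ b)) (fun b x => by
      have h : (σ (x * treeGen ((σ x)⁻¹ b)))⁻¹ b = (σ x)⁻¹ b := by
        rw [Equiv.Perm.inv_eq_iff_eq, hσ, perm_apply_inv]
      simp only [h, mul_treeGen_treeGen])
  have hfst : ∀ x, (φ x).1 = x := by
    intro x
    induction x using treeVertex_induction with
    | one => rw [hφ1]
    | mul_gen x a ih => rw [hφ, ih]
  have hsnd : ∀ x a, (φ (x * treeGen a)).2 = (φ x).2 * treeGen (σ x a) := by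
    intro x a
    rw [hφ, hfst]
  let e : TreeVertex d ≃ TreeVertex d :=
    { toFun := fun x => (φ x).2
      invFun := ψ
      left_inv := by
        intro x
        induction x using treeVertex_induction with
        | one => simp only [hφ1, hψ1]
        | mul_gen x a ih =>
          simp only at ih
          simp only [hsnd, hψ, ih, perm_inv_apply]
      right_inv := by
        intro x
        induction x using treeVertex_induction with
        | one => simp only [hψ1, hφ1]
        | mul_gen x a ih =>
          simp only at ih
          simp only [hψ, hsnd, ih, perm_apply_inv] }
  have he : ∀ x a, e (x * treeGen a) = e x * treeGen (σ x a) := hsnd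
  let g : GraphAut (regularTree d) :=
    { toEquiv := e
      map_rel_iff' := by
        intro x y
        constructor
        · rintro ⟨b, hb⟩
          refine ⟨(σ x)⁻¹ b, e.injective ?_⟩
          rw [he, perm_apply_inv, hb]
        · rintro ⟨a, rfl⟩
          exact ⟨σ x a, he x a⟩ }
  refine ⟨g, ?_, fun x => locPerm_eq_iff.mpr (he x)⟩
  change (φ 1).2 = 1
  rw [hφ1]

/-! ### The permutation topology -/

section Topology

variable {V : Type*} {T : SimpleGraph V}

/-- Stated for any map into V → V so as to cover both the full group and its subgroups. -/
theorem isOpen_induced_fun_iff {X : Type*} (c : X → V → V) (U : Set X) :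
    @IsOpen X (TopologicalSpace.induced c (@Pi.topologicalSpace V (fun _ => V) (fun _ => ⊥))) U ↔
      ∀ g ∈ U, ∃ S : Finset V, ∀ g' : X, (∀ x ∈ S, c g' x = c g x) → g' ∈ U := by
  let : TopologicalSpace V := ⊥
  have : DiscreteTopology V := ⟨rfl⟩
  constructor
  · rintro ⟨O, hO, rfl⟩ g hg
    obtain ⟨S, u, hu, hS⟩ := isOpen_pi_iff.mp hO (c g) hg
    exact ⟨S, fun g' h => hS fun x hx => by rw [h x hx]; exact (hu x hx).2⟩
  · intro h
    choose! S hS using h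
    refine ⟨⋃ g ∈ U, {φ | ∀ x ∈ S g, φ x = c g x}, ?_, ?_⟩
    · refine isOpen_biUnion fun g _ => ?_
      have : {φ : V → V | ∀ x ∈ S g, φ x = c g x} = (S g : Set V).pi fun x => {c g x} := by
        ext φ
        simp [Set.mem_pi]
      rw [this]
      exact isOpen_set_pi (S g).finite_toSet fun _ _ => isOpen_discrete _
    · ext g'
      simp only [Set.mem_preimage, Set.mem_iUnion]
      exact ⟨fun ⟨g, hg, h⟩ => hS g hg g' h, fun h => ⟨g', h, fun _ _ => rfl⟩⟩

theorem isOpen_graphAut_iff (U : Set (GraphAut T)) :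
    IsOpen U ↔ ∀ g ∈ U, ∃ S : Finset V, ∀ g' : GraphAut T, (∀ x ∈ S, g' x = g x) → g' ∈ U :=
  isOpen_induced_fun_iff (fun g : GraphAut T => (g : V → V)) U

theorem isOpen_subgroup_iff {H : Subgroup (GraphAut T)} (U : Set H) :
    IsOpen U ↔ ∀ g ∈ U, ∃ S : Finset V, ∀ g' : H,
      (∀ x ∈ S, (g' : GraphAut T) x = (g : GraphAut T) x) → g' ∈ U := by
  rw [← isOpen_induced_fun_iff (fun g : H => ((g : GraphAut T) : V → V)) U]
  have h : (inferInstance : TopologicalSpace H) =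
      TopologicalSpace.induced (fun g : H => ((g : GraphAut T) : V → V))
        (@Pi.topologicalSpace V (fun _ => V) (fun _ => ⊥)) := induced_compose
  rw [← h]

/-- A subgroup is closed under pointwise limits. -/
def IsLimitClosed (H : Subgroup (GraphAut T)) : Prop :=
  ∀ g : GraphAut T, (∀ S : Finset V, ∃ h ∈ H, ∀ x ∈ S, h x = g x) → g ∈ H

theorem IsLimitClosed.isClosed {H : Subgroup (GraphAut T)} (hH : IsLimitClosed H) :
    IsClosed (H : Set (GraphAut T)) := by
  rw [← isOpen_compl_iff, isOpen_graphAut_iff]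
  intro g hg
  by_contra! hcon
  refine hg (hH g fun S => ?_)
  obtain ⟨g', h1, h2⟩ := hcon S
  exact ⟨g', by simpa using h2, h1⟩

theorem IsLimitClosed.inf {H K : Subgroup (GraphAut T)} (hH : IsLimitClosed H)
    (hK : IsLimitClosed K) : IsLimitClosed (H ⊓ K) := fun g hg =>
  ⟨hH g fun S => (hg S).imp fun _ h => ⟨h.1.1, h.2⟩,
    hK g fun S => (hg S).imp fun _ h => ⟨h.1.2, h.2⟩⟩

theorem not_discreteTopology_of_approx {H : Subgroup (GraphAut T)}
    (h : ∀ S : Finset V, ∃ g ∈ H, g ≠ 1 ∧ ∀ x ∈ S, g x = x) : ¬ DiscreteTopology H := by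
  intro hd
  obtain ⟨S, hS⟩ := (isOpen_subgroup_iff ({1} : Set H)).mp (isOpen_discrete _) 1 rfl
  obtain ⟨g, hg, hne, hfix⟩ := h S
  exact hne (congrArg Subtype.val (hS ⟨g, hg⟩ hfix))

/-- The pointwise stabilizer of a finite set is open, and a subgroup containing an open subgroup is
open. -/
theorem mem_quasiCenter_of_commute {H : Subgroup (GraphAut T)} (h : H) (S : Finset V)
    (hS : ∀ g ∈ H, (∀ x ∈ S, g x = x) → g * (h : GraphAut T) = h * g) : h ∈ quasiCenter H := by
  refine (isOpen_subgroup_iff _).mpr fun g hg => ⟨S, fun g' hg' => ?_⟩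
  have key : g⁻¹ * g' ∈ Subgroup.centralizer {h} := by
    rw [Subgroup.mem_centralizer_singleton_iff]
    refine Subtype.ext (hS _ (g⁻¹ * g').2 fun x hx => ?_)
    change (g : GraphAut T)⁻¹ ((g' : GraphAut T) x) = x
    rw [hg' x hx]
    exact RelIso.inv_apply_self _ _
  simpa using mul_mem hg key

end Topology

/-! ### Compactness -/

theorem finite_dist_le {d : ℕ} (n : ℕ) : {v | (regularTree d).dist 1 v ≤ n}.Finite := by
  have key : ∀ (m : ℕ) (u : TreeVertex d),
      {v | ∃ w : (regularTree d).Walk u v, w.length = m}.Finite := by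
    intro m
    induction m with
    | zero =>
      intro u
      refine (Set.finite_singleton u).subset ?_
      rintro v ⟨w, hw⟩
      exact (SimpleGraph.Walk.eq_of_length_eq_zero hw).symm
    | succ m ih =>
      intro u
      refine (Set.finite_iUnion fun a : Fin d => ih (u * treeGen a)).subset ?_
      rintro v ⟨w, hw⟩
      cases w with
      | nil => simp at hw
      | cons h q =>
        obtain ⟨a, ha⟩ := h
        subst ha
        exact Set.mem_iUnion.mpr ⟨a, q, Nat.succ_injective hw⟩
  refine (Set.Finite.biUnion (Set.finite_le_nat n) fun m _ => key m 1).subset fun v hv => ?_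
  obtain ⟨w, hw⟩ := (regularTree_connected d).exists_walk_length_eq_dist 1 v
  exact Set.mem_biUnion (show (regularTree d).dist 1 v ∈ {i | i ≤ n} from hv) ⟨w, hw⟩

theorem dist_one_aut_le {d : ℕ} (g : GraphAut (regularTree d)) (x : TreeVertex d) :
    (regularTree d).dist 1 (g x) ≤ (regularTree d).dist 1 (g 1) + (regularTree d).dist 1 x := by
  rw [← dist_aut g 1 x]
  exact (regularTree_connected d).dist_triangle

theorem dist_one_inv {d : ℕ} (g : GraphAut (regularTree d)) :
    (regularTree d).dist 1 (g⁻¹ 1) = (regularTree d).dist 1 (g 1) := by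
  rw [← dist_aut g 1 (g⁻¹ 1), RelIso.apply_inv_self, SimpleGraph.dist_comm]

/-- Elements of bounded displacement at 1 send each vertex into a finite ball, and so do their
inverses. An ultrafilter therefore makes the values of g and of g⁻¹ at each vertex eventually
constant, and the two limits are inverse automorphisms. -/
theorem isCompact_dist_le {d : ℕ} {H : Subgroup (GraphAut (regularTree d))}
    (hH : IsLimitClosed H) (r : ℕ) :
    IsCompact {g : H | (regularTree d).dist 1 ((g : GraphAut (regularTree d)) 1) ≤ r} := by
  rw [isCompact_iff_ultrafilter_le_nhds]
  intro f hf
  rw [Filter.le_principal_iff] at hf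
  have key : ∀ c : H → GraphAut (regularTree d),
      (∀ g, (regularTree d).dist 1 (c g 1) =
        (regularTree d).dist 1 ((g : GraphAut (regularTree d)) 1)) →
      ∀ x, ∃ y, ∀ᶠ g in (f : Filter H), c g x = y := by
    intro c hc x
    have hmem : (⋃ y ∈ {v | (regularTree d).dist 1 v ≤ r + (regularTree d).dist 1 x},
        {g : H | c g x = y}) ∈ f := by
      refine Filter.mem_of_superset hf fun g hg => ?_
      refine Set.mem_biUnion (show c g x ∈ _ from ?_) rfl
      have h1 := dist_one_aut_le (c g) x
      rw [hc] at h1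
      exact h1.trans (Nat.add_le_add_right hg _)
    obtain ⟨y, -, hy⟩ := (Ultrafilter.finite_biUnion_mem_iff (finite_dist_le _)).mp hmem
    exact ⟨y, hy⟩
  choose φ hφ using key (fun g => g) fun _ => rfl
  choose ψ hψ using key (fun g => (g : GraphAut (regularTree d))⁻¹) fun g => dist_one_inv _
  let l : GraphAut (regularTree d) :=
    { toFun := φ
      invFun := ψ
      left_inv := fun x => by
        obtain ⟨g, h1, h2⟩ := ((hφ x).and (hψ (φ x))).exists
        rw [← h2, ← h1]
        exact RelIso.inv_apply_self _ _
      right_inv := fun x => by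
        obtain ⟨g, h1, h2⟩ := ((hψ x).and (hφ (ψ x))).exists
        rw [← h2, ← h1]
        exact RelIso.apply_inv_self _ _
      map_rel_iff' := by
        intro x y
        obtain ⟨g, h1, h2⟩ := ((hφ x).and (hφ y)).exists
        change (regularTree d).Adj (φ x) (φ y) ↔ _
        rw [← h1, ← h2]
        exact (g : GraphAut (regularTree d)).map_rel_iff }
  have hl : ∀ S : Finset (TreeVertex d),
      ∀ᶠ g : H in (f : Filter H), ∀ x ∈ S, (g : GraphAut (regularTree d)) x = l x := fun S =>
    (Filter.eventually_all_finset S).mpr fun x _ => hφ x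
  have hlH : l ∈ H := hH l fun S => by
    obtain ⟨g, hg⟩ := (hl S).exists
    exact ⟨g, g.2, hg⟩
  refine ⟨⟨l, hlH⟩, ?_, ?_⟩
  · obtain ⟨g, h1, h2⟩ := ((hφ 1).and hf).exists
    change (regularTree d).dist 1 (φ 1) ≤ r
    rw [← h1]
    exact h2
  · rw [le_nhds_iff]
    intro U hU hUo
    obtain ⟨S, hS⟩ := (isOpen_subgroup_iff U).mp hUo _ hU
    exact Filter.mem_of_superset (hl S) fun g hg => hS g hg

/-! ### Vertices that are products of few generators -/

theorem adj_one_treeGen {d : ℕ} (x : TreeVertex d) (a : Fin d) :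
    (regularTree d).Adj x (x * treeGen a) := ⟨a, rfl⟩

theorem dist_mul_treeGen {d : ℕ} (x : TreeVertex d) (a : Fin d) :
    (regularTree d).dist x (x * treeGen a) = 1 :=
  SimpleGraph.dist_eq_one_iff_adj.mpr (adj_one_treeGen x a)

theorem dist_mul_treeGen_mul_treeGen_le {d : ℕ} (x : TreeVertex d) (a b : Fin d) :
    (regularTree d).dist x (x * (treeGen a * treeGen b)) ≤ 2 := by
  have h := (regularTree_connected d).dist_triangle (u := x) (v := x * treeGen a)
    (w := x * treeGen a * treeGen b)
  rw [dist_mul_treeGen, dist_mul_treeGen, mul_assoc] at h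
  exact h

theorem closure_dist_le_two (d : ℕ) :
    Subgroup.closure {x : TreeVertex d | x ∈ (⊤ : Subgroup (TreeVertex d)) ∧
      (regularTree d).dist 1 x ≤ 2} = ⊤ := by
  rw [eq_top_iff]
  intro x _
  induction x using treeVertex_induction with
  | one => exact one_mem _
  | mul_gen x a ih =>
    refine mul_mem (ih trivial) (Subgroup.subset_closure ⟨trivial, ?_⟩)
    have := dist_mul_treeGen 1 a
    rw [one_mul] at this
    omega

/-- Products of two generators already suffice: every vertex lies in the subgroup they generate or
one generator away from it, and parity excludes the latter for even vertices. -/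
theorem closure_even_dist_le_two (d : ℕ) :
    Subgroup.closure {x : TreeVertex d | x ∈ (treeParity d).ker ∧
      (regularTree d).dist 1 x ≤ 2} = (treeParity d).ker := by
  set C := Subgroup.closure {x : TreeVertex d | x ∈ (treeParity d).ker ∧
      (regularTree d).dist 1 x ≤ 2} with hC
  have hle : C ≤ (treeParity d).ker := (Subgroup.closure_le _).mpr fun x hx => hx.1
  refine hle.antisymm fun x hx => ?_
  have hpair : ∀ a b : Fin d, treeGen a * treeGen b ∈ C := fun a b => by
    refine Subgroup.subset_closure ⟨?_, ?_⟩
    · rw [MonoidHom.mem_ker, map_mul, treeParity_treeGen, treeParity_treeGen]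
      decide
    · have := dist_mul_treeGen_mul_treeGen_le 1 a b
      rwa [one_mul] at this
  have key : ∀ y : TreeVertex d, y ∈ C ∨ ∃ a, y * treeGen a ∈ C := by
    intro y
    induction y using treeVertex_induction with
    | one => exact Or.inl (one_mem _)
    | mul_gen y a ih =>
      rcases ih with h | ⟨b, h⟩
      · exact Or.inr ⟨a, by rwa [mul_treeGen_treeGen]⟩
      · have := mul_mem h (hpair b a)
        rw [← mul_assoc, mul_treeGen_treeGen] at this
        exact Or.inl this
  rcases key x with h | ⟨a, h⟩
  · exact h
  · exfalso
    have h1 := hle h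
    rw [MonoidHom.mem_ker, map_mul, treeParity_treeGen, MonoidHom.mem_ker.mp hx] at h1
    revert h1
    decide

/-! ### Compact generation -/

/-- The compact set of elements moving 1 by at most 2 generates: it contains enough label-respecting
automorphisms to carry g 1 back to 1, and it contains the stabilizer of 1. Radius 2 rather than 1 is
needed when E consists of the even vertices. -/
theorem isCompactlyGenerated_of_labelAut {d : ℕ} {H : Subgroup (GraphAut (regularTree d))}
    (hH : IsLimitClosed H) (E : Subgroup (TreeVertex d))
    (hE : Subgroup.closure {x : TreeVertex d | x ∈ E ∧ (regularTree d).dist 1 x ≤ 2} = E)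
    (hlabel : ∀ x ∈ E, labelAut x ∈ H) (hmem : ∀ g ∈ H, g 1 ∈ E) :
    IsCompactlyGeneratedGroup H := by
  refine ⟨{g : H | (regularTree d).dist 1 ((g : GraphAut (regularTree d)) 1) ≤ 2},
    isCompact_dist_le hH 2, ?_⟩
  rw [eq_top_iff]
  rintro ⟨g, hg⟩ -
  set K := {g : H | (regularTree d).dist 1 ((g : GraphAut (regularTree d)) 1) ≤ 2}
  have key : ∀ x ∈ Subgroup.closure {x : TreeVertex d | x ∈ E ∧ (regularTree d).dist 1 x ≤ 2},
      ∃ h : labelAut x ∈ H, (⟨labelAut x, h⟩ : H) ∈ Subgroup.closure K := by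
    intro x hx
    induction hx using Subgroup.closure_induction with
    | mem x hx =>
      refine ⟨hlabel x hx.1, Subgroup.subset_closure ?_⟩
      change (regularTree d).dist 1 (labelAut x 1) ≤ 2
      rw [← dist_one_inv, labelAut_inv_one]
      exact hx.2
    | one =>
      have : (⟨labelAut 1, by rw [labelAut_one]; exact one_mem _⟩ : H) = 1 :=
        Subtype.ext labelAut_one
      exact ⟨_, this ▸ one_mem _⟩
    | mul x y _ _ hx hy =>
      obtain ⟨h1, h2⟩ := hx
      obtain ⟨h3, h4⟩ := hy
      have : (⟨labelAut (x * y), by rw [labelAut_mul]; exact mul_mem h3 h1⟩ : H) =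
        ⟨labelAut y, h3⟩ * ⟨labelAut x, h1⟩ := Subtype.ext (labelAut_mul x y)
      exact ⟨_, this ▸ mul_mem h4 h2⟩
    | inv x _ hx =>
      obtain ⟨h1, h2⟩ := hx
      have : (⟨labelAut x⁻¹, by rw [labelAut_inv]; exact inv_mem h1⟩ : H) =
        ⟨labelAut x, h1⟩⁻¹ := Subtype.ext (labelAut_inv x)
      exact ⟨_, this ▸ inv_mem h2⟩
  obtain ⟨h1, h2⟩ := key (g 1) (by rw [hE]; exact hmem g hg)
  have h3 : (⟨labelAut (g 1), h1⟩ * ⟨g, hg⟩ : H) ∈ Subgroup.closure K := by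
    refine Subgroup.subset_closure ?_
    change (regularTree d).dist 1 (labelAut (g 1) (g 1)) ≤ 2
    rw [labelAut_self]
    simp
  exact (Subgroup.mul_mem_cancel_left _ h2).mp h3

/-! ### Intersections of generalized universal groups -/

/-- The restrictions to the ball of radius `k` of the elements of the stabilizer of the base
vertex. -/
def ballRestriction {d : ℕ} (H : Subgroup (GraphAut (regularTree d))) (k : ℕ) :
    Subgroup (GraphAut (ballTree d k)) where
  carrier := {φ | ∃ g ∈ H, ∃ h : g 1 = 1, restrictBall k g h = φ}
  one_mem' := ⟨1, one_mem _, rfl, rfl⟩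
  mul_mem' := by
    rintro _ _ ⟨g, hg, hg1, rfl⟩ ⟨h, hh, hh1, rfl⟩
    exact ⟨g * h, mul_mem hg hh, by rw [RelIso.mul_apply, hh1, hg1], rfl⟩
  inv_mem' := by
    rintro _ ⟨g, hg, hg1, rfl⟩
    exact ⟨g⁻¹, inv_mem hg, aut_inv_one hg1, rfl⟩

theorem sigma_mem_ballRestriction {d : ℕ} {H : Subgroup (GraphAut (regularTree d))} (k : ℕ)
    {g : GraphAut (regularTree d)} {x : TreeVertex d} (h : localAut g x ∈ H) :
    sigma k g x ∈ ballRestriction H k := ⟨_, h, localAut_one g x, rfl⟩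

/-- Agreement with elements of H on balls of unbounded radius makes the local action of g a limit of
elements of H. The radius function r covers both the radii k and the radii 2k. -/
theorem localAut_mem_of_sigma {d : ℕ} {H : Subgroup (GraphAut (regularTree d))}
    (hH : IsLimitClosed H) {g : GraphAut (regularTree d)} {x : TreeVertex d} (r : ℕ → ℕ)
    (hr : ∀ n, n ≤ r n) (h : ∀ k, 1 ≤ k → sigma (r k) g x ∈ ballRestriction H (r k)) :
    localAut g x ∈ H := by
  refine hH _ fun S => ?_
  obtain ⟨n, hn⟩ : ∃ n, ∀ v ∈ S, (regularTree d).dist 1 v ≤ n :=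
    ⟨S.sup fun v => (regularTree d).dist 1 v, fun v hv =>
      Finset.le_sup (f := fun v => (regularTree d).dist 1 v) hv⟩
  -- The successor only ensures that the index is at least 1.
  obtain ⟨g', hg', h1, h2⟩ := h (n + 1) (Nat.le_add_left 1 n)
  refine ⟨g', hg', fun v hv => ?_⟩
  have hv' : v ∈ ballSet d (r (n + 1)) :=
    (hn v hv).trans ((Nat.le_succ n).trans (hr (n + 1)))
  exact congrArg Subtype.val (DFunLike.congr_fun h2 ⟨v, hv'⟩)

theorem mem_of_localAut_mem {d : ℕ} {H : Subgroup (GraphAut (regularTree d))}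
    {g : GraphAut (regularTree d)} (h1 : labelAut (g 1) ∈ H) (h : localAut g 1 ∈ H) : g ∈ H := by
  have : localAut g 1 = labelAut (g 1) * g := by
    rw [localAut, labelAut_one, inv_one, mul_one]
  rw [this] at h
  exact (Subgroup.mul_mem_cancel_left _ h1).mp h

/-- Since H contains the label-respecting automorphisms, conjugating an element into a local action
at any vertex stays inside H; conversely the condition at the base vertex alone already forces
membership. -/
theorem isUniversalIntersection_of_labelAut {d : ℕ} {H : Subgroup (GraphAut (regularTree d))}
    (hH : IsLimitClosed H) (hlabel : ∀ x, labelAut x ∈ H) : IsUniversalIntersection H := by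
  refine ⟨ballRestriction H, le_antisymm ?_ ?_⟩
  · refine le_iInf₂ fun k _ g hg x => sigma_mem_ballRestriction k ?_
    exact mul_mem (mul_mem (hlabel _) hg) (inv_mem (hlabel x))
  · intro g hg
    simp only [Subgroup.mem_iInf] at hg
    exact mem_of_localAut_mem (hlabel _)
      (localAut_mem_of_sigma hH id (fun _ => le_rfl) fun k hk => hg k hk 1)

theorem isBipartiteUniversalIntersection_of_labelAut {d : ℕ}
    {H : Subgroup (GraphAut (regularTree d))} (hH : IsLimitClosed H) (hle : H ≤ bipartiteAut d)
    (hlabel : ∀ x ∈ evenVertices d, labelAut x ∈ H) : IsBipartiteUniversalIntersection H := by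
  refine ⟨fun k => ballRestriction H (2 * k), le_antisymm ?_ ?_⟩
  · refine le_iInf₂ fun k _ g hg => ⟨hle hg, fun x hx => sigma_mem_ballRestriction _ ?_⟩
    exact mul_mem (mul_mem (hlabel _ ((hle hg x).mpr hx)) hg) (inv_mem (hlabel x hx))
  · intro g hg
    simp only [Subgroup.mem_iInf] at hg
    have h1 : (1 : TreeVertex d) ∈ evenVertices d := by rw [mem_evenVertices_iff, map_one]
    exact mem_of_localAut_mem (hlabel _ (((hg 1 le_rfl).1 1).mpr h1))
      (localAut_mem_of_sigma hH (fun k => 2 * k) (fun n => Nat.le_mul_of_pos_left n two_pos)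
        fun k hk => (hg k hk).2 1 h1)

/-- Induction along geodesics from the base vertex. -/
theorem treeVertex_dist_induction {d : ℕ} {P : TreeVertex d → Prop} (one : P 1)
    (mul_gen : ∀ x a, (regularTree d).dist 1 (x * treeGen a) = (regularTree d).dist 1 x + 1 →
      P x → P (x * treeGen a)) (x : TreeVertex d) : P x := by
  obtain ⟨n, hn⟩ : ∃ n, (regularTree d).dist x 1 = n := ⟨_, rfl⟩
  induction n generalizing x with
  | zero =>
    rw [(regularTree_connected d).dist_eq_zero_iff.mp hn]
    exact one
  | succ n ih =>
    obtain ⟨w, hw⟩ := (regularTree_connected d).exists_walk_length_eq_dist x 1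
    cases w with
    | nil => rw [SimpleGraph.dist_self] at hn; omega
    | @cons _ y _ h q =>
      rw [SimpleGraph.Walk.length_cons] at hw
      have h1 : (regularTree d).dist y 1 ≤ q.length := SimpleGraph.dist_le q
      have h2 := (regularTree_connected d).dist_triangle (u := x) (v := y) (w := 1)
      rw [SimpleGraph.dist_eq_one_iff_adj.mpr h] at h2
      obtain ⟨a, ha⟩ := h
      have hx : x = y * treeGen a := by rw [ha, mul_treeGen_treeGen]
      rw [hx]
      refine mul_gen y a ?_ (ih y (by omega))
      rw [← hx, SimpleGraph.dist_comm, SimpleGraph.dist_comm (u := 1) (v := y)]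
      omega

/-! ### Groups of lifts

A partial retraction `rep` of the set of labels onto a set of representatives defines an
endomorphism `proj` of the free product `TreeVertex d`, whose fibres are the orbits of a group of
automorphisms of the tree. We consider the automorphisms that permute the fibres and whose local
permutations are constant on the fibres. -/

structure FiberDatum (d : ℕ) where
  rep : Fin d → Option (Fin d)
  rep_idem : ∀ a i, rep a = some i → rep i = some i
  /-- the group of local permutations -/
  F : Subgroup (Equiv.Perm (Fin d))
  rep_congr : ∀ f ∈ F, ∀ a b, rep a = rep b → rep (f a) = rep (f b)
  rep_none : ∀ f ∈ F, ∀ a, rep a = none → rep (f a) = none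
  /-- a group normalized by `F` on which the local permutations of an automorphism act alike -/
  N : Subgroup (Equiv.Perm (Fin d))
  conj_mem : ∀ f ∈ F, ∀ n ∈ N, f * n * f⁻¹ ∈ N

namespace FiberDatum

variable {d : ℕ} (D : FiberDatum d)

/-- The homomorphism that replaces labels by their representatives. -/
def proj : TreeVertex d →* TreeVertex d :=
  treeLift (fun a => (D.rep a).elim 1 treeGen) fun a => by
    cases D.rep a with
    | none => exact mul_one _
    | some i => exact treeGen_mul_self i

theorem proj_treeGen (a : Fin d) : D.proj (treeGen a) = (D.rep a).elim 1 treeGen :=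
  treeLift_treeGen _ _ _

theorem proj_treeGen_of_none {a : Fin d} (h : D.rep a = none) : D.proj (treeGen a) = 1 := by
  rw [proj_treeGen, h]
  rfl

theorem proj_treeGen_of_some {a i : Fin d} (h : D.rep a = some i) :
    D.proj (treeGen a) = treeGen i := by
  rw [proj_treeGen, h]
  rfl

theorem proj_treeGen_congr {a b : Fin d} (h : D.rep a = D.rep b) :
    D.proj (treeGen a) = D.proj (treeGen b) := by
  rw [proj_treeGen, proj_treeGen, h]

theorem mul_proj_treeGen_cancel (x : TreeVertex d) (a : Fin d) :
    x * D.proj (treeGen a) * D.proj (treeGen a) = x := by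
  rw [mul_assoc, ← map_mul, treeGen_mul_self, map_one, mul_one]

/-- The automorphisms that permute the fibres of `proj`, with local permutations in `F` that are
constant on the fibres and act on `N` by one and the same automorphism. -/
noncomputable def group : Subgroup (GraphAut (regularTree d)) where
  carrier := {g | (∀ x, locPerm g x ∈ D.F) ∧
    (∀ x y, ∀ n ∈ D.N, locPerm g x * n * (locPerm g x)⁻¹ = locPerm g y * n * (locPerm g y)⁻¹) ∧
    (∀ x y, D.proj (g x) = D.proj (g y) ↔ D.proj x = D.proj y) ∧
    (∀ x y, D.proj x = D.proj y → locPerm g x = locPerm g y)}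
  one_mem' := by
    refine ⟨fun x => ?_, fun x y n _ => ?_, fun x y => Iff.rfl, fun x y _ => ?_⟩ <;> simp [one_mem]
  mul_mem' := by
    rintro g h ⟨g1, g2, g3, g4⟩ ⟨h1, h2, h3, h4⟩
    refine ⟨fun x => ?_, fun x y n hn => ?_, fun x y => (g3 _ _).trans (h3 x y), fun x y hxy => ?_⟩
    · rw [locPerm_mul]
      exact mul_mem (g1 _) (h1 _)
    · have e1 := h2 x y n hn
      have e2 := g2 (h x) (h y) _ (D.conj_mem _ (h1 x) n hn)
      rw [locPerm_mul, locPerm_mul]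
      calc _ = locPerm g (h x) * (locPerm h x * n * (locPerm h x)⁻¹) * (locPerm g (h x))⁻¹ := by
              group
        _ = _ := by
              rw [e2, e1]
              group
    · rw [locPerm_mul, locPerm_mul, h4 x y hxy, g4 _ _ ((h3 x y).mpr hxy)]
  inv_mem' := by
    rintro g ⟨g1, g2, g3, g4⟩
    have h3 : ∀ x y, D.proj (g⁻¹ x) = D.proj (g⁻¹ y) ↔ D.proj x = D.proj y := fun x y => by
      rw [← g3, RelIso.apply_inv_self, RelIso.apply_inv_self]
    refine ⟨fun x => ?_, fun x y n hn => ?_, h3, fun x y hxy => ?_⟩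
    · rw [locPerm_inv]
      exact inv_mem (g1 _)
    · rw [locPerm_inv, locPerm_inv]
      set a := locPerm g (g⁻¹ x)
      set b := locPerm g (g⁻¹ y)
      -- The condition for g⁻¹ at n is that for g at a⁻¹na, which lies in N because F normalizes N.
      have e := g2 (g⁻¹ x) (g⁻¹ y) (a⁻¹ * n * a) (by
        simpa using D.conj_mem _ (inv_mem (g1 (g⁻¹ x))) n hn)
      change a * (a⁻¹ * n * a) * a⁻¹ = b * (a⁻¹ * n * a) * b⁻¹ at e
      have e' : n = b * (a⁻¹ * n * a) * b⁻¹ := by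
        rw [← e]
        group
      calc _ = a⁻¹ * n * a := by group
        _ = b⁻¹ * (b * (a⁻¹ * n * a) * b⁻¹) * b := by group
        _ = _ := by
          rw [← e']
          group
    · rw [locPerm_inv, locPerm_inv, g4 _ _ ((h3 x y).mpr hxy)]

/-- Each defining condition concerns at most two vertices and the local permutations there, hence is
tested on two vertices and their neighbours. -/
theorem isLimitClosed_group : IsLimitClosed D.group := by
  intro g hg
  have key : ∀ x y, ∃ h ∈ D.group, h x = g x ∧ h y = g y ∧ locPerm h x = locPerm g x ∧
      locPerm h y = locPerm g y := by
    intro x y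
    classical
    obtain ⟨h, hh, hS⟩ := hg ({x, y} ∪ Finset.univ.image (fun a => x * treeGen a) ∪
      Finset.univ.image fun a => y * treeGen a)
    have hx := hS x (by simp)
    have hy := hS y (by simp)
    refine ⟨h, hh, hx, hy, locPerm_eq_iff.mpr fun a => ?_, locPerm_eq_iff.mpr fun a => ?_⟩
    · rw [hS _ (by simp), hx, apply_mul_treeGen]
    · rw [hS _ (by simp), hy, apply_mul_treeGen]
  refine ⟨fun x => ?_, fun x y n hn => ?_, fun x y => ?_, fun x y hxy => ?_⟩
  · obtain ⟨h, hh, -, -, e, -⟩ := key x x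
    exact e ▸ hh.1 x
  · obtain ⟨h, hh, -, -, e1, e2⟩ := key x y
    rw [← e1, ← e2]
    exact hh.2.1 x y n hn
  · obtain ⟨h, hh, e1, e2, -, -⟩ := key x y
    rw [← e1, ← e2]
    exact hh.2.2.1 x y
  · obtain ⟨h, hh, -, -, e1, e2⟩ := key x y
    rw [← e1, ← e2]
    exact hh.2.2.2 x y hxy

theorem labelAut_mem_group (x : TreeVertex d) : labelAut x ∈ D.group := by
  refine ⟨fun y => ?_, fun y z n _ => ?_, fun y z => ?_, fun y z _ => ?_⟩
  · rw [locPerm_labelAut]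
    exact one_mem _
  · rw [locPerm_labelAut, locPerm_labelAut]
  · rw [labelAut_apply, labelAut_apply, map_mul, map_mul, mul_right_inj]
  · rw [locPerm_labelAut, locPerm_labelAut]

/-- Compatible families of local permutations that are constant on the fibres are realized. -/
theorem exists_mem_group (σ : TreeVertex d → Equiv.Perm (Fin d)) (hF : ∀ q, σ q ∈ D.F)
    (hN : ∀ q r, ∀ n ∈ D.N, σ q * n * (σ q)⁻¹ = σ r * n * (σ r)⁻¹)
    (hrep : ∀ q i a, D.rep a = some i → σ (q * treeGen i) a = σ q a)
    (hgen : ∀ q i, σ (q * treeGen i) i = σ q i) :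
    ∃ g ∈ D.group, g 1 = 1 ∧ ∀ x, locPerm g x = σ (D.proj x) := by
  have hproj : ∀ q a, σ (q * D.proj (treeGen a)) a = σ q a := by
    intro q a
    cases h : D.rep a with
    | none => rw [D.proj_treeGen_of_none h, mul_one]
    | some i => rw [D.proj_treeGen_of_some h, hrep q i a h]
  obtain ⟨g, hg1, hg⟩ := exists_aut_locPerm (fun x => σ (D.proj x)) fun x a => by
    rw [map_mul, hproj]
  -- The map induced on fibres: φ computes `proj (g x)` from `proj x`, and ψ below recovers `proj x`
  -- from `proj (g x)`. Together they show that g permutes the fibres.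
  obtain ⟨φ, hφ1, hφ⟩ := exists_treeRec ((1, 1) : TreeVertex d × TreeVertex d)
    (fun i x => (x.1 * treeGen i, x.2 * D.proj (treeGen (σ x.1 i))))
    (fun i x => by simp only [hgen, mul_treeGen_treeGen, mul_proj_treeGen_cancel])
  obtain ⟨ψ, hψ1, hψ⟩ := exists_treeRec (1 : TreeVertex d)
    (fun i r => r * D.proj (treeGen ((σ r)⁻¹ i))) (fun i r => by
      have h : (σ (r * D.proj (treeGen ((σ r)⁻¹ i))))⁻¹ i = (σ r)⁻¹ i := by
        rw [Equiv.Perm.inv_eq_iff_eq, hproj, perm_apply_inv]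
      simp only [h, mul_proj_treeGen_cancel])
  have hfst : ∀ q, (φ q).1 = q := by
    intro q
    induction q using treeVertex_induction with
    | one => rw [hφ1]
    | mul_gen q i ih => rw [hφ, ih]
  have hforth : ∀ x, D.proj (g x) = (φ (D.proj x)).2 := by
    intro x
    induction x using treeVertex_induction with
    | one => rw [hg1, map_one, hφ1]
    | mul_gen x a ih =>
      rw [apply_mul_treeGen, map_mul, map_mul, ih, hg]
      cases h : D.rep a with
      | none =>
        rw [D.proj_treeGen_of_none h, D.proj_treeGen_of_none (D.rep_none _ (hF _) a h), mul_one,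
          mul_one]
      | some i =>
        rw [D.proj_treeGen_of_some h, hφ, hfst, D.proj_treeGen_congr
          (D.rep_congr _ (hF _) a i (h.trans (D.rep_idem a i h).symm))]
  have hback : ∀ x, ψ (D.proj (g x)) = D.proj x := by
    intro x
    induction x using treeVertex_induction with
    | one => rw [hg1, map_one, hψ1]
    | mul_gen x a ih =>
      rw [apply_mul_treeGen, map_mul, map_mul, hg]
      have ha : (σ (D.proj x))⁻¹ (σ (D.proj x) a) = a := perm_inv_apply _ a
      generalize σ (D.proj x) a = c at ha ⊢
      cases h : D.rep c with
      | none =>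
        have := D.rep_none _ (inv_mem (hF (D.proj x))) c h
        rw [ha] at this
        rw [D.proj_treeGen_of_none h, D.proj_treeGen_of_none this, mul_one, mul_one, ih]
      | some j =>
        have := D.rep_congr _ (inv_mem (hF (D.proj x))) c j (h.trans (D.rep_idem c j h).symm)
        rw [ha] at this
        rw [D.proj_treeGen_of_some h, hψ, ih, D.proj_treeGen_congr this]
  refine ⟨g, ⟨fun x => ?_, fun x y n hn => ?_, fun x y => ⟨fun h => ?_, fun h => ?_⟩,
    fun x y h => ?_⟩, hg1, hg⟩
  · rw [hg]
    exact hF _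
  · rw [hg, hg]
    exact hN _ _ n hn
  · rw [← hback x, h, hback]
  · rw [hforth, h, hforth]
  · rw [hg, hg, h]

theorem exists_mem_group_const {f : Equiv.Perm (Fin d)} (hf : f ∈ D.F) :
    ∃ g ∈ D.group, g 1 = 1 ∧ ∀ x, locPerm g x = f :=
  D.exists_mem_group (fun _ => f) (fun _ => hf) (fun _ _ _ _ => rfl) (fun _ _ _ _ => rfl)
    fun _ _ => rfl

/-- There is an element that maps the base vertex to `w` and has constant local permutations. -/
theorem exists_mem_group_affine {f : Equiv.Perm (Fin d)} (hf : f ∈ D.F) (w : TreeVertex d) :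
    ∃ g ∈ D.group, g 1 = w ∧ ∀ x, locPerm g x = f := by
  obtain ⟨g, hg, hg1, hgf⟩ := D.exists_mem_group_const hf
  refine ⟨labelAut w⁻¹ * g, mul_mem (D.labelAut_mem_group _) hg, ?_, fun x => ?_⟩
  · rw [RelIso.mul_apply, hg1, labelAut_apply, inv_inv, mul_one]
  · rw [locPerm_mul, locPerm_labelAut, hgf, one_mul]

/-- A subgroup of the group of lifts that contains all its vertex stabilizers. -/
structure IsStabilizerFull (H : Subgroup (GraphAut (regularTree d))) : Prop where
  le : H ≤ D.group
  mem : ∀ g ∈ D.group, ∀ x, g x = x → g ∈ H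

theorem isStabilizerFull_group : D.IsStabilizerFull D.group := ⟨le_rfl, fun _ h _ _ => h⟩

theorem isStabilizerFull_inf_bipartiteAut : D.IsStabilizerFull (D.group ⊓ bipartiteAut d) :=
  ⟨inf_le_left, fun _ hg x hx => ⟨hg, mem_bipartiteAut_of_treeParity (x := x) (by rw [hx])⟩⟩

variable {D}

/-- Every f in F occurs at the base vertex as a constant local permutation, and conjugation by a
label-respecting automorphism transports it to x. -/
theorem IsStabilizerFull.localAction_eq {H : Subgroup (GraphAut (regularTree d))}
    (hH : D.IsStabilizerFull H) (x : TreeVertex d) :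
    localAction H x = D.F.map (neighborEquiv d x).permCongrHom.toMonoidHom := by
  ext p
  constructor
  · rintro ⟨g, hg, hgx, hp⟩
    refine ⟨locPerm g x, (hH.le hg).1 x, Equiv.ext fun y => ?_⟩
    obtain ⟨a, rfl⟩ := (neighborEquiv d x).surjective y
    refine Subtype.ext ?_
    rw [hp]
    have h : (neighborEquiv d x).permCongrHom (locPerm g x) (neighborEquiv d x a) =
        neighborEquiv d x (locPerm g x a) := by
      simp [Equiv.permCongrHom]
    refine (congrArg Subtype.val h).trans ?_
    change x * treeGen (locPerm g x a) = g (x * treeGen a)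
    rw [apply_mul_treeGen, hgx]
  · rintro ⟨f, hf, rfl⟩
    obtain ⟨g, hg, hg1, hgf⟩ := D.exists_mem_group_const hf
    have hx : ((labelAut x)⁻¹ * g * labelAut x) x = x := by
      rw [RelIso.mul_apply, RelIso.mul_apply, labelAut_self, hg1, labelAut_inv_one]
    have hm := D.labelAut_mem_group x
    refine ⟨_, hH.mem _ (mul_mem (mul_mem (inv_mem hm) hg) hm) x hx, hx, fun y => ?_⟩
    obtain ⟨a, rfl⟩ := (neighborEquiv d x).surjective y
    have h : (neighborEquiv d x).permCongrHom f (neighborEquiv d x a) =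
        neighborEquiv d x (f a) := by
      simp [Equiv.permCongrHom]
    refine (congrArg Subtype.val h).trans ?_
    change x * treeGen (f a) = ((labelAut x)⁻¹ * g * labelAut x) (x * treeGen a)
    rw [apply_mul_treeGen, hx, locPerm_mul, locPerm_mul, hgf, locPerm_labelAut, ← labelAut_inv,
      locPerm_labelAut, mul_one, one_mul]

theorem IsStabilizerFull.mem_quasiCenter {H : Subgroup (GraphAut (regularTree d))}
    (hH : D.IsStabilizerFull H) (h : H) {n : Equiv.Perm (Fin d)} (hn : n ∈ D.N)
    (hrep : ∀ a, D.rep (n a) = D.rep a)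
    (hproj : D.proj ((h : GraphAut (regularTree d)) 1) = 1)
    (hh : ∀ x, locPerm (h : GraphAut (regularTree d)) x = n) : h ∈ quasiCenter H := by
  obtain ⟨h, hhH⟩ := h
  simp only at hproj hh
  have hfib : ∀ x, D.proj (h x) = D.proj x := by
    intro x
    induction x using treeVertex_induction with
    | one => rw [hproj, map_one]
    | mul_gen x a ih =>
      rw [apply_mul_treeGen, map_mul, map_mul, ih, hh, D.proj_treeGen_congr (hrep a)]
  classical
  -- Fixing 1 and its neighbours trivializes the local permutation at 1; fixing h 1 makes the two
  -- products agree at 1.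
  refine mem_quasiCenter_of_commute _ ({1, h 1} ∪ Finset.univ.image treeGen) fun g hg hfix => ?_
  obtain ⟨-, g2, -, g4⟩ := hH.le hg
  have h1 : g 1 = 1 := hfix 1 (by simp)
  have hw : g (h 1) = h 1 := hfix _ (by simp)
  have hloc : locPerm g 1 = 1 := by
    refine locPerm_eq_iff.mpr fun a => ?_
    rw [one_mul, h1, one_mul]
    exact hfix _ (by simp)
  refine aut_ext ?_ fun x => ?_
  · change g (h 1) = h (g 1)
    rw [hw, h1]
  · have e := g2 x 1 n hn
    rw [hloc, one_mul, inv_one, mul_one, mul_inv_eq_iff_eq_mul] at e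
    rw [locPerm_mul, locPerm_mul, hh, hh, g4 _ _ (hfib x), e]

end FiberDatum

/-! ### A depth function -/

/-- The action on the integers for which the generator `i₀` acts by the reflection in `1 / 2` and
all the other generators by the reflection in `0`. -/
def dihedralAction {d : ℕ} (i₀ : Fin d) : TreeVertex d →* Equiv.Perm ℤ :=
  treeLift (fun a => if a = i₀ then Equiv.subLeft 1 else Equiv.neg ℤ) fun a => by
    ext x
    split_ifs <;> simp

theorem dihedralAction_self {d : ℕ} (i₀ : Fin d) (x : ℤ) :
    dihedralAction i₀ (treeGen i₀) x = 1 - x := by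
  simp [dihedralAction]

theorem dihedralAction_of_ne {d : ℕ} {i₀ a : Fin d} (h : a ≠ i₀) (x : ℤ) :
    dihedralAction i₀ (treeGen a) x = -x := by
  simp [dihedralAction, h]

theorem dihedralAction_pow {d : ℕ} {i₀ a : Fin d} (h : a ≠ i₀) (k : ℕ) :
    dihedralAction i₀ ((treeGen i₀ * treeGen a) ^ k) 0 = k := by
  induction k with
  | zero => simp
  | succ k ih =>
    rw [pow_succ', map_mul, Equiv.Perm.mul_apply, ih, map_mul, Equiv.Perm.mul_apply,
      dihedralAction_of_ne h, dihedralAction_self]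
    push_cast
    ring

theorem dihedralAction_isometry {d : ℕ} (i₀ : Fin d) (q : TreeVertex d) (x y : ℤ) :
    |dihedralAction i₀ q x - dihedralAction i₀ q y| = |x - y| := by
  induction q using treeVertex_induction generalizing x y with
  | one => simp
  | mul_gen q a ih =>
    rw [map_mul, Equiv.Perm.mul_apply, Equiv.Perm.mul_apply, ih]
    by_cases h : a = i₀
    · subst h
      rw [dihedralAction_self, dihedralAction_self, abs_sub_comm]
      ring_nf
    · rw [dihedralAction_of_ne h, dihedralAction_of_ne h, abs_sub_comm]
      ring_nf

/-- The depth of a vertex; it changes along edges with label `i₀` only. -/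
def depth {d : ℕ} (i₀ : Fin d) (q : TreeVertex d) : ℤ := |dihedralAction i₀ q 0|

theorem depth_mul_of_ne {d : ℕ} {i₀ a : Fin d} (h : a ≠ i₀) (q : TreeVertex d) :
    depth i₀ (q * treeGen a) = depth i₀ q := by
  rw [depth, map_mul, Equiv.Perm.mul_apply, dihedralAction_of_ne h, neg_zero, depth]

theorem depth_mul_le {d : ℕ} (i₀ a : Fin d) (q : TreeVertex d) :
    depth i₀ (q * treeGen a) ≤ depth i₀ q + 1 := by
  by_cases h : a = i₀
  · subst h
    rw [depth, map_mul, Equiv.Perm.mul_apply, dihedralAction_self, sub_zero, depth]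
    have h1 := dihedralAction_isometry a q 1 0
    have h2 := abs_sub_abs_le_abs_sub (dihedralAction a q 1) (dihedralAction a q 0)
    rw [h1] at h2
    norm_num at h2
    linarith
  · rw [depth_mul_of_ne h]
    linarith

/-! ### Non-discreteness of groups of lifts -/

namespace FiberDatum

variable {d : ℕ} {D : FiberDatum d}

/-- Applying `proj` does not lengthen words, and each letter raises the depth by at most 1. -/
theorem depth_proj_le (i₀ : Fin d) (x : TreeVertex d) :
    depth i₀ (D.proj x) ≤ (regularTree d).dist 1 x := by
  induction x using treeVertex_dist_induction with
  | one => simp [depth]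
  | mul_gen x a hd ih =>
    rw [hd, map_mul]
    push_cast
    cases h : D.rep a with
    | none =>
      rw [D.proj_treeGen_of_none h, mul_one]
      linarith
    | some i =>
      rw [D.proj_treeGen_of_some h]
      have := depth_mul_le i₀ i (D.proj x)
      linarith

theorem IsStabilizerFull.not_discreteTopology {H : Subgroup (GraphAut (regularTree d))}
    (hH : D.IsStabilizerFull H) {f : Equiv.Perm (Fin d)} (hf : f ∈ D.F) (hf1 : f ≠ 1)
    (hcomm : ∀ n ∈ D.N, f * n = n * f) {i₀ j : Fin d} (hi : D.rep i₀ = some i₀)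
    (hfix : ∀ a, D.rep a = some i₀ → f a = a) (hj : D.rep j = some j) (hji : j ≠ i₀) :
    ¬ DiscreteTopology H := by
  refine not_discreteTopology_of_approx fun S => ?_
  obtain ⟨n, hn⟩ : ∃ n, ∀ v ∈ S, (regularTree d).dist 1 v ≤ n :=
    ⟨S.sup fun v => (regularTree d).dist 1 v, fun v hv =>
      Finset.le_sup (f := fun v => (regularTree d).dist 1 v) hv⟩
  -- The depth jumps only across i₀-edges, where compatibility holds because f fixes all labels
  -- represented by i₀.
  set σ : TreeVertex d → Equiv.Perm (Fin d) := fun q => if n < depth i₀ q then f else 1 with hσ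
  have hσ' : ∀ q, σ q = f ∨ σ q = 1 := fun q => by
    by_cases h : n < depth i₀ q
    · exact Or.inl (if_pos h)
    · exact Or.inr (if_neg h)
  have hconj : ∀ q, ∀ m ∈ D.N, σ q * m * (σ q)⁻¹ = m := fun q m hm => by
    rcases hσ' q with h | h
    · rw [h, hcomm m hm, mul_inv_cancel_right]
    · rw [h, one_mul, inv_one, mul_one]
  have hrep : ∀ q i a, D.rep a = some i → σ (q * treeGen i) a = σ q a := by
    intro q i a ha
    by_cases h : i = i₀
    · subst h
      have key : ∀ r, σ r a = a := fun r => by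
        rcases hσ' r with h | h
        · rw [h, hfix a ha]
        · rw [h, Equiv.Perm.one_apply]
      rw [key, key]
    · rw [hσ]
      simp only [depth_mul_of_ne h]
  have hgen : ∀ q i, σ (q * treeGen i) i = σ q i := by
    intro q i
    by_cases h : i = i₀
    · subst h
      exact hrep q i i hi
    · rw [hσ]
      simp only [depth_mul_of_ne h]
  obtain ⟨g, hg, hg1, hgσ⟩ := D.exists_mem_group σ
    (fun q => (hσ' q).elim (fun h => h ▸ hf) fun h => h ▸ one_mem _)
    (fun q r m hm => by rw [hconj q m hm, hconj r m hm]) hrep hgen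
  refine ⟨g, hH.mem g hg 1 hg1, ?_, fun v hv => ?_⟩
  · rintro rfl
    -- This vertex has depth n + 1, and `proj` fixes it because i₀ and j represent themselves; so
    -- the local permutation there is f.
    have hq : D.proj ((treeGen i₀ * treeGen j) ^ (n + 1)) = (treeGen i₀ * treeGen j) ^ (n + 1) := by
      rw [map_pow, map_mul, D.proj_treeGen_of_some hi, D.proj_treeGen_of_some hj]
    have h := hgσ ((treeGen i₀ * treeGen j) ^ (n + 1))
    rw [hq, locPerm_one] at h
    have hd : (n : ℤ) < depth i₀ ((treeGen i₀ * treeGen j) ^ (n + 1)) := by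
      rw [depth, dihedralAction_pow hji]
      push_cast
      rw [abs_of_nonneg (by positivity)]
      linarith
    refine hf1 (h.trans ?_).symm
    exact if_pos hd
  · have key : ∀ x : TreeVertex d, (regularTree d).dist 1 x ≤ n → g x = x := by
      intro x
      induction x using treeVertex_dist_induction with
      | one => exact fun _ => hg1
      | mul_gen x a hd ih =>
        intro hx
        have h1 : ¬ (n : ℤ) < depth i₀ (D.proj x) := by
          have := depth_proj_le (D := D) i₀ x
          omega
        have h2 : locPerm g x = 1 := (hgσ x).trans (if_neg h1)
        rw [apply_mul_treeGen, h2, ih (by omega), Equiv.Perm.one_apply]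
    exact key v (hn v hv)

theorem isUniversalIntersection_group (D : FiberDatum d) : IsUniversalIntersection D.group :=
  isUniversalIntersection_of_labelAut D.isLimitClosed_group D.labelAut_mem_group

theorem isCompactlyGenerated_group (D : FiberDatum d) : IsCompactlyGeneratedGroup D.group :=
  isCompactlyGenerated_of_labelAut D.isLimitClosed_group ⊤ (closure_dist_le_two d)
    (fun x _ => D.labelAut_mem_group x) fun _ _ => trivial

end FiberDatum

/-! ### Subgroups preserving the bipartition -/

theorem isLimitClosed_bipartiteAut (d : ℕ) : IsLimitClosed (bipartiteAut d) := by
  intro g hg x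
  obtain ⟨h, hh, hS⟩ := hg {x}
  rw [← hS x (Finset.mem_singleton_self x)]
  exact hh x

namespace FiberDatum

variable {d : ℕ} (D : FiberDatum d)

theorem isLimitClosed_inf_bipartiteAut : IsLimitClosed (D.group ⊓ bipartiteAut d) :=
  D.isLimitClosed_group.inf (isLimitClosed_bipartiteAut d)

theorem labelAut_mem_inf_bipartiteAut {x : TreeVertex d} (hx : treeParity d x = 1) :
    labelAut x ∈ D.group ⊓ bipartiteAut d := by
  refine ⟨D.labelAut_mem_group x, mem_bipartiteAut_of_treeParity (x := x) ?_⟩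
  rw [labelAut_self, hx, map_one]

theorem isBipartiteUniversalIntersection_inf_bipartiteAut :
    IsBipartiteUniversalIntersection (D.group ⊓ bipartiteAut d) :=
  isBipartiteUniversalIntersection_of_labelAut D.isLimitClosed_inf_bipartiteAut inf_le_right
    fun x hx => D.labelAut_mem_inf_bipartiteAut ((mem_evenVertices_iff x).mp hx)

theorem isCompactlyGenerated_inf_bipartiteAut :
    IsCompactlyGeneratedGroup (D.group ⊓ bipartiteAut d : Subgroup (GraphAut (regularTree d))) := by
  refine isCompactlyGenerated_of_labelAut D.isLimitClosed_inf_bipartiteAut (treeParity d).ker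
    (closure_even_dist_le_two d) (fun x hx => D.labelAut_mem_inf_bipartiteAut hx) fun g hg => ?_
  refine (mem_evenVertices_iff _).mp ((hg.2 1).mpr ?_)
  rw [mem_evenVertices_iff, map_one]

end FiberDatum

/-! ### Translation lengths -/

theorem translationLength_eq {d : ℕ} {g : GraphAut (regularTree d)} {n : ℕ} (x : TreeVertex d)
    (hx : (regularTree d).dist x (g x) = n) (hmin : ∀ y, n ≤ (regularTree d).dist y (g y)) :
    translationLength g = n := by
  refine le_antisymm (Nat.sInf_le ⟨x, hx⟩) (le_csInf ⟨_, x, rfl⟩ ?_)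
  rintro _ ⟨y, rfl⟩
  exact hmin y

theorem isElliptic_of_apply_eq {d : ℕ} {g : GraphAut (regularTree d)} {x : TreeVertex d}
    (hx : g x = x) : IsElliptic g :=
  translationLength_eq x (by rw [hx, SimpleGraph.dist_self]) fun _ => Nat.zero_le _

theorem dist_pos_of_ne {d : ℕ} {x y : TreeVertex d} (h : x ≠ y) : 0 < (regularTree d).dist x y :=
  (regularTree_connected d).pos_dist_of_ne h

/-- The function that distinguishes the two half-trees of the edge between `1` and `treeGen a`. -/
theorem exists_halfTree {d : ℕ} (a : Fin d) : ∃ β : TreeVertex d → Prop,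
    (∀ x b, ¬ (b = a ∧ (x = 1 ∨ x = treeGen a)) → (β (x * treeGen b) ↔ β x)) ∧
      ∀ x, β (treeGen a * x) ↔ ¬ β x := by
  classical
  have hinv : ∀ x : TreeVertex d, x * treeGen a = 1 ↔ x = treeGen a := fun x => by
    rw [mul_eq_one_iff_eq_inv, treeGen_inv]
  have hstep : ∀ b (x : TreeVertex d), (b = a ∧ (x * treeGen b = 1 ∨ x * treeGen b = treeGen a)) ↔
      (b = a ∧ (x = 1 ∨ x = treeGen a)) := by
    intro b x
    refine and_congr_right ?_
    rintro rfl
    rw [hinv, mul_eq_right, or_comm]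
  obtain ⟨φ, h1, hφ⟩ := exists_treeRec ((1, False) : TreeVertex d × Prop)
    (fun b x => (x.1 * treeGen b, if b = a ∧ (x.1 = 1 ∨ x.1 = treeGen a) then ¬ x.2 else x.2))
    (fun b x => by
      refine Prod.ext (mul_treeGen_treeGen _ _) ?_
      simp only [hstep]
      split_ifs
      · exact propext not_not
      · rfl)
  have hfst : ∀ x, (φ x).1 = x := by
    intro x
    induction x using treeVertex_induction with
    | one => rw [h1]
    | mul_gen x b ih => rw [hφ, ih]
  have hsnd : ∀ x b, (φ (x * treeGen b)).2 =
      if b = a ∧ (x = 1 ∨ x = treeGen a) then ¬ (φ x).2 else (φ x).2 := fun x b => by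
    rw [hφ, hfst]
  refine ⟨fun x => (φ x).2, fun x b h => by simp only [hsnd, if_neg h], fun x => ?_⟩
  induction x using treeVertex_induction with
  | one =>
    have := hsnd 1 a
    rw [if_pos ⟨rfl, Or.inl rfl⟩, one_mul] at this
    simp only [mul_one, this]
  | mul_gen x b ih =>
    have hx : (b = a ∧ (treeGen a * x = 1 ∨ treeGen a * x = treeGen a)) ↔
        (b = a ∧ (x = 1 ∨ x = treeGen a)) := by
      rw [mul_eq_one_iff_inv_eq, treeGen_inv, mul_eq_left, or_comm, eq_comm (a := treeGen a)]
    simp only [← mul_assoc, hsnd, hx]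
    split_ifs
    · exact not_congr ih
    · exact ih

theorem isInversion_labelAut_treeGen {d : ℕ} (a : Fin d) : IsInversion (labelAut (treeGen a)) := by
  have happ : ∀ x, labelAut (treeGen a) x = treeGen a * x := fun x => by
    rw [labelAut_apply, treeGen_inv]
  have hl : translationLength (labelAut (treeGen a)) = 1 := by
    refine translationLength_eq 1 ?_ fun y => ?_
    · rw [happ, mul_one, ← one_mul (treeGen a), dist_mul_treeGen]
    · refine dist_pos_of_ne fun h => treeGen_ne_one a ?_
      rw [happ] at h
      exact right_eq_mul.mp h
  refine ⟨by rw [hl]; exact one_pos, (Set.toFinite {1, treeGen a}).subset fun x hx => ?_⟩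
  have hx' : (regularTree d).dist x (labelAut (treeGen a) x) = 1 := hl ▸ hx
  obtain ⟨b, hb⟩ := SimpleGraph.dist_eq_one_iff_adj.mp hx'
  rw [happ] at hb
  obtain ⟨β, h1, h2⟩ := exists_halfTree a
  by_contra hcon
  -- Crossing an edge other than the one between 1 and `treeGen a` keeps β, whereas left
  -- multiplication by `treeGen a` negates it.
  have h3 := h1 x b fun h => hcon h.2
  rw [← hb, h2] at h3
  exact not_iff_self h3

theorem infinite_of_pow_mem {d : ℕ} {a b : Fin d} (hab : b ≠ a) {S : Set (TreeVertex d)}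
    (h : ∀ k : ℕ, (treeGen a * treeGen b) ^ k ∈ S) : S.Infinite := by
  refine Set.infinite_of_injective_forall_mem (f := fun k : ℕ => (treeGen a * treeGen b) ^ k)
    (fun k l hkl => ?_) h
  have := congrArg (fun x => dihedralAction a x 0) hkl
  simp only [dihedralAction_pow hab] at this
  exact_mod_cast this

/-- Such a g exchanges the parity classes, so it has no fixed vertex; it moves each vertex (ab)^k to
the adjacent vertex (ab)^k a. -/
theorem isHyperbolic_of_affine {d : ℕ} {g : GraphAut (regularTree d)} {a b : Fin d} (hab : b ≠ a)
    {τ : Equiv.Perm (Fin d)} (hτa : τ a = b) (hτb : τ b = a) (hg1 : g 1 = treeGen a)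
    (hg : ∀ x, locPerm g x = τ) : IsHyperbolic g ∧ translationLength g = 1 := by
  have hl : translationLength g = 1 := by
    refine translationLength_eq 1 ?_ fun y => ?_
    · rw [hg1, ← one_mul (treeGen a), dist_mul_treeGen]
    · refine dist_pos_of_ne fun h => ?_
      have hb := mem_bipartiteAut_of_treeParity (g := g) (x := y) (by rw [← h])
      have h1 := (hb 1).mpr (by rw [mem_evenVertices_iff, map_one])
      rw [hg1, mem_evenVertices_iff, treeParity_treeGen] at h1
      revert h1
      decide
  refine ⟨⟨by rw [hl]; exact one_pos, infinite_of_pow_mem hab fun k => ?_⟩, hl⟩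
  have hk : g ((treeGen a * treeGen b) ^ k) = (treeGen a * treeGen b) ^ k * treeGen a := by
    induction k with
    | zero => rw [pow_zero, hg1, one_mul]
    | succ k ih =>
      rw [pow_succ, ← mul_assoc, apply_mul_treeGen, apply_mul_treeGen, ih, hg, hg, hτa, hτb]
  change (regularTree d).dist _ _ = _
  rw [hl, hk, dist_mul_treeGen]

/-- This is left multiplication by ab: it acts freely and preserves parity, so every displacement is
at least 2, with equality at the powers of ab. -/
theorem isHyperbolic_labelAut {d : ℕ} {a b : Fin d} (hab : b ≠ a) :
    IsHyperbolic (labelAut (treeGen b * treeGen a)) ∧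
      translationLength (labelAut (treeGen b * treeGen a)) = 2 := by
  have happ : ∀ x, labelAut (treeGen b * treeGen a) x = treeGen a * treeGen b * x := fun x => by
    rw [labelAut_apply, mul_inv_rev, treeGen_inv, treeGen_inv]
  have hpow : ∀ k : ℕ, labelAut (treeGen b * treeGen a) ((treeGen a * treeGen b) ^ k) =
      (treeGen a * treeGen b) ^ k * (treeGen a * treeGen b) := fun k => by
    rw [happ, ← pow_succ', pow_succ]
  have hmin : ∀ y, 2 ≤ (regularTree d).dist y (labelAut (treeGen b * treeGen a) y) := by
    intro y
    have h0 : 0 < (regularTree d).dist y (labelAut (treeGen b * treeGen a) y) := by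
      refine dist_pos_of_ne fun h => hab (treeGen_injective d ?_)
      rw [happ] at h
      rw [← treeGen_inv a]
      exact (inv_eq_of_mul_eq_one_right (right_eq_mul.mp h)).symm
    have h1 : Even ((regularTree d).dist y (labelAut (treeGen b * treeGen a) y)) := by
      rw [even_dist_iff, happ, map_mul, map_mul, treeParity_treeGen, treeParity_treeGen]
      generalize treeParity d y = i
      revert i
      decide
    obtain ⟨m, hm⟩ := h1
    omega
  have hdist : ∀ k : ℕ, (regularTree d).dist ((treeGen a * treeGen b) ^ k)
      (labelAut (treeGen b * treeGen a) ((treeGen a * treeGen b) ^ k)) = 2 := fun k => by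
    refine le_antisymm ?_ (hmin _)
    rw [hpow]
    exact dist_mul_treeGen_mul_treeGen_le _ _ _
  have hl := translationLength_eq _ (hdist 0) hmin
  refine ⟨⟨by rw [hl]; exact two_pos, infinite_of_pow_mem hab fun k => ?_⟩, hl⟩
  change (regularTree d).dist _ _ = _
  rw [hl, hdist]

/-! ### Transitivity properties of permutation groups -/

/-- A normal subgroup that is not semiregular contains a non-trivial element with a fixed point,
whose normal closure is everything. -/
theorem isSemiprimitivePerm_range {G X : Type*} [Group G] (φ : G →* Equiv.Perm X)
    (htrans : ∀ x y, ∃ g, φ g x = y)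
    (hnormal : ∀ g, φ g ≠ 1 → (∃ x, φ g x = x) → Subgroup.normalClosure {g} = ⊤) :
    IsSemiprimitivePerm φ.range := by
  have htop : ∀ N : Subgroup (Equiv.Perm X), (∀ g, φ g ∈ N) → MulAction.IsPretransitive N X :=
    fun N hN => ⟨fun x y => (htrans x y).imp' (fun g => ⟨φ g, hN g⟩) fun g h => h⟩
  refine ⟨htop _ fun g => ⟨g, rfl⟩, fun N hle hN => or_iff_not_imp_right.mpr fun hreg => ?_⟩
  simp only [IsSemiregularPerm, not_forall] at hreg
  obtain ⟨σ, hσ, x, hx, hne⟩ := hreg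
  obtain ⟨g, rfl⟩ := hle hσ
  have hcomap : (N.comap φ).Normal := ⟨fun n hn g => by
    have := hN.conj_mem ⟨φ n, n, rfl⟩ hn ⟨φ g, g, rfl⟩
    rw [Subgroup.mem_comap, map_mul, map_mul, map_inv]
    exact this⟩
  have h := Subgroup.normalClosure_le_normal (N := N.comap φ) (Set.singleton_subset_iff.mpr hσ)
  rw [hnormal g hne ⟨x, hx⟩] at h
  exact htop N fun g => h trivial

theorem isQuasiprimitivePerm_range {G X : Type*} [Group G] [IsSimpleGroup G]
    (φ : G →* Equiv.Perm X) (htrans : ∀ x y, ∃ g, φ g x = y) : IsQuasiprimitivePerm φ.range := by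
  have htop : ∀ N : Subgroup (Equiv.Perm X), (∀ g, φ g ∈ N) → MulAction.IsPretransitive N X :=
    fun N hN => ⟨fun x y => (htrans x y).imp' (fun g => ⟨φ g, hN g⟩) fun g h => h⟩
  refine ⟨htop _ fun g => ⟨g, rfl⟩, fun N hle hN hne => ?_⟩
  have hcomap : (N.comap φ).Normal := ⟨fun n hn g => by
    have := hN.conj_mem ⟨φ n, n, rfl⟩ hn ⟨φ g, g, rfl⟩
    rw [Subgroup.mem_comap, map_mul, map_mul, map_inv]
    exact this⟩
  rcases hcomap.eq_bot_or_eq_top with h | h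
  · refine absurd (eq_bot_iff.mpr fun σ hσ => ?_) hne
    obtain ⟨g, rfl⟩ := hle hσ
    have hg : g ∈ N.comap φ := hσ
    rw [h, Subgroup.mem_bot] at hg
    rw [hg, map_one]
    exact one_mem _
  · exact htop N fun g => by
      have hg : g ∈ N.comap φ := h ▸ Subgroup.mem_top g
      exact hg

/-! ### Local transitivity of groups of lifts -/

namespace FiberDatum

variable {d : ℕ} {D : FiberDatum d}

theorem IsStabilizerFull.localAction_apply_iff {H : Subgroup (GraphAut (regularTree d))}
    (hH : D.IsStabilizerFull H) (x : TreeVertex d) (a b : Fin d) :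
    (∃ p ∈ localAction H x, p (neighborEquiv d x a) = neighborEquiv d x b) ↔
      ∃ f ∈ D.F, f a = b := by
  rw [hH.localAction_eq]
  have key : ∀ f : Equiv.Perm (Fin d), (neighborEquiv d x).permCongrHom f (neighborEquiv d x a) =
      neighborEquiv d x (f a) := fun f => by simp [Equiv.permCongrHom]
  constructor
  · rintro ⟨_, ⟨f, hf, rfl⟩, h⟩
    exact ⟨f, hf, (neighborEquiv d x).injective ((key f).symm.trans h)⟩
  · rintro ⟨f, hf, rfl⟩
    exact ⟨_, ⟨f, hf, rfl⟩, key f⟩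

theorem IsStabilizerFull.locallyTransitive {H : Subgroup (GraphAut (regularTree d))}
    (hH : D.IsStabilizerFull H) (h : ∀ a b, ∃ f ∈ D.F, f a = b) : LocallyTransitive H := by
  refine fun x => ⟨fun y z => ?_⟩
  obtain ⟨a, rfl⟩ := (neighborEquiv d x).surjective y
  obtain ⟨b, rfl⟩ := (neighborEquiv d x).surjective z
  obtain ⟨p, hp, hpa⟩ := (hH.localAction_apply_iff x a b).mpr (h a b)
  exact ⟨⟨p, hp⟩, hpa⟩

theorem IsStabilizerFull.locallyIntransitive {H : Subgroup (GraphAut (regularTree d))}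
    (hH : D.IsStabilizerFull H) (a b : Fin d) (h : ∀ f ∈ D.F, f a ≠ b) :
    LocallyIntransitive H := by
  rintro x ⟨hx⟩
  obtain ⟨⟨p, hp⟩, hpa⟩ := hx (neighborEquiv d x a) (neighborEquiv d x b)
  obtain ⟨f, hf, hfa⟩ := (hH.localAction_apply_iff x a b).mp ⟨p, hp, hpa⟩
  exact h f hf hfa

theorem isClosedNondiscreteCompGen_group (hd : ¬ DiscreteTopology D.group) :
    IsClosedNondiscreteCompGen D.group :=
  ⟨D.isLimitClosed_group.isClosed, hd, D.isCompactlyGenerated_group⟩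

theorem isClosedNondiscreteCompGen_inf_bipartiteAut
    (hd : ¬ DiscreteTopology (D.group ⊓ bipartiteAut d : Subgroup (GraphAut (regularTree d)))) :
    IsClosedNondiscreteCompGen (D.group ⊓ bipartiteAut d) :=
  ⟨D.isLimitClosed_inf_bipartiteAut.isClosed, hd, D.isCompactlyGenerated_inf_bipartiteAut⟩

/-! ### Deleting labels -/

/-- The labels in `K` are deleted, and the local permutations preserve `K`. -/
def deletion {d : ℕ} (K : Finset (Fin d)) : FiberDatum d where
  rep a := if a ∈ K then none else some a
  rep_idem a i h := by
    split_ifs at h with ha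
    obtain rfl := Option.some_inj.mp h
    exact if_neg ha
  F :=
    { carrier := {f | ∀ a, f a ∈ K ↔ a ∈ K}
      one_mem' := fun _ => Iff.rfl
      mul_mem' := fun hf hg a => (hf _).trans (hg a)
      inv_mem' := fun {f} hf a => by rw [← hf, perm_apply_inv] }
  rep_congr f hf a b h := by
    have hf' : ∀ a, f a ∈ K ↔ a ∈ K := hf
    simp only [hf']
    split_ifs at h ⊢ with ha hb
    · rfl
    · rw [Option.some_inj.mp h]
  rep_none f hf a h := by
    have hf' : ∀ a, f a ∈ K ↔ a ∈ K := hf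
    simp only [hf']
    split_ifs at h ⊢
    rfl
  N := Subgroup.centralizer {f | ∀ a, f a ∈ K ↔ a ∈ K}
  conj_mem f hf n hn := by
    rw [Subgroup.mem_centralizer_iff.mp hn f hf, mul_inv_cancel_right]
    exact hn

theorem deletion_rep_of_mem {K : Finset (Fin d)} {a : Fin d} (h : a ∈ K) :
    (deletion K).rep a = none := if_pos h

theorem deletion_rep_of_notMem {K : Finset (Fin d)} {a : Fin d} (h : a ∉ K) :
    (deletion K).rep a = some a := if_neg h

theorem deletion_not_discreteTopology {K : Finset (Fin d)} {i a b : Fin d} (hi : i ∉ K)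
    (ha : a ∉ K) (hb : b ∉ K) (hab : a ≠ b) (hia : i ≠ a) (hib : i ≠ b) :
    ¬ DiscreteTopology (deletion K).group := by
  have hf : Equiv.swap a b ∈ (deletion K).F := by
    intro c
    rw [Equiv.swap_apply_def]
    split_ifs with h1 h2
    · subst h1
      exact iff_of_false hb ha
    · subst h2
      exact iff_of_false ha hb
    · rfl
  refine (isStabilizerFull_group _).not_discreteTopology hf ?_
    (fun n hn => Subgroup.mem_centralizer_iff.mp hn _ hf) (deletion_rep_of_notMem hi) (fun c hc => ?_)
    (deletion_rep_of_notMem ha) hia.symm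
  · rwa [Ne, Equiv.swap_eq_one_iff]
  · by_cases h : c ∈ K
    · rw [deletion_rep_of_mem h] at hc
      exact absurd hc (by simp)
    · rw [deletion_rep_of_notMem h, Option.some_inj] at hc
      subst hc
      exact Equiv.swap_apply_of_ne_of_ne hia hib

theorem deletion_locallyIntransitive {K : Finset (Fin d)} {a b : Fin d} (ha : a ∈ K)
    (hb : b ∉ K) : LocallyIntransitive (deletion K).group :=
  (isStabilizerFull_group _).locallyIntransitive a b fun f hf h =>
    hb (h ▸ ((show ∀ a, f a ∈ K ↔ a ∈ K from hf) a).mpr ha)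

/-! ### Identifying labels in the cycles of a permutation -/

/-- The labels in the same cycle of `τ` are identified, where `τ` centralizes the group of local
permutations. -/
noncomputable def ofCentralizing {d : ℕ} (τ : Equiv.Perm (Fin d)) (F : Subgroup (Equiv.Perm (Fin d)))
    (hF : ∀ f ∈ F, Commute f τ) : FiberDatum d where
  rep a := some (Quotient.out (Quotient.mk (Equiv.Perm.SameCycle.setoid τ) a))
  rep_idem a i h := by
    obtain rfl := Option.some_inj.mp h
    rw [Quotient.out_eq]
  F := F
  rep_congr f hf a b h := by
    rw [Option.some_inj, Quotient.out_inj] at h ⊢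
    obtain ⟨k, hk⟩ : Equiv.Perm.SameCycle τ a b := Quotient.exact h
    refine Quotient.sound (s := Equiv.Perm.SameCycle.setoid τ) ⟨k, ?_⟩
    rw [← hk, ← Equiv.Perm.mul_apply, ← Equiv.Perm.mul_apply, ((hF f hf).zpow_right k).eq]
  rep_none f hf a h := absurd h (by simp)
  N := Subgroup.centralizer F
  conj_mem f hf n hn := by
    rw [Subgroup.mem_centralizer_iff.mp hn f hf, mul_inv_cancel_right]
    exact hn

variable {τ : Equiv.Perm (Fin d)} {F : Subgroup (Equiv.Perm (Fin d))}
  {hF : ∀ f ∈ F, Commute f τ}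

theorem ofCentralizing_rep_eq_iff {a b : Fin d} :
    (ofCentralizing τ F hF).rep a = (ofCentralizing τ F hF).rep b ↔
      Equiv.Perm.SameCycle τ a b := by
  change some _ = some _ ↔ _
  rw [Option.some_inj, Quotient.out_inj, Quotient.eq]
  rfl

theorem ofCentralizing_rep_apply (a : Fin d) :
    (ofCentralizing τ F hF).rep (τ a) = (ofCentralizing τ F hF).rep a :=
  ofCentralizing_rep_eq_iff.mpr (Equiv.Perm.sameCycle_apply_left.mpr (Equiv.Perm.SameCycle.refl τ a))

/-- As f commutes with τ, it fixes the whole τ-cycle of a, whose representative serves as i₀. The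
cycle of b is a different one because f moves b. -/
theorem ofCentralizing_not_discreteTopology {f : Equiv.Perm (Fin d)} (hf : f ∈ F) {a b : Fin d}
    (ha : f a = a) (hb : f b ≠ b) {H : Subgroup (GraphAut (regularTree d))}
    (hH : (ofCentralizing τ F hF).IsStabilizerFull H) : ¬ DiscreteTopology H := by
  set D := ofCentralizing τ F hF with hD
  have hsome : ∀ a, ∃ i, D.rep a = some i := fun a => ⟨_, rfl⟩
  obtain ⟨i, hi⟩ := hsome a
  obtain ⟨j, hj⟩ := hsome b
  have hfix : ∀ c, D.rep c = some i → f c = c := by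
    intro c hc
    obtain ⟨k, rfl⟩ := ofCentralizing_rep_eq_iff.mp (hi.trans hc.symm)
    rw [← Equiv.Perm.mul_apply, ((hF f hf).zpow_right k).eq, Equiv.Perm.mul_apply, ha]
  refine hH.not_discreteTopology hf ?_ (fun n hn => Subgroup.mem_centralizer_iff.mp hn f hf)
    (D.rep_idem a i hi) hfix (D.rep_idem b j hj) ?_
  · rintro rfl
    exact hb rfl
  · rintro rfl
    exact hb (hfix b hj)

end FiberDatum

/-! ### Identifying labels in pairs -/

namespace FiberDatum

/-- Four labels, identified in two pairs; the local permutations preserve the pairing. -/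
def pairing : FiberDatum 4 where
  rep := ![some 0, some 0, some 2, some 2]
  rep_idem := by decide
  F :=
    { carrier := {f | ∀ a b, (![some 0, some 0, some 2, some 2] : Fin 4 → Option (Fin 4)) (f a) =
        (![some 0, some 0, some 2, some 2] : Fin 4 → Option (Fin 4)) (f b) ↔
        (![some 0, some 0, some 2, some 2] : Fin 4 → Option (Fin 4)) a =
        (![some 0, some 0, some 2, some 2] : Fin 4 → Option (Fin 4)) b}
      one_mem' := fun _ _ => Iff.rfl
      mul_mem' := fun hf hg a b => (hf _ _).trans (hg a b)
      inv_mem' := fun {f} hf a b => by rw [← hf, perm_apply_inv, perm_apply_inv] }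
  rep_congr f hf a b h := (hf a b).mpr h
  rep_none f hf a h := absurd h (by revert a; decide)
  N :=
    { carrier := {n | ∀ a, (![some 0, some 0, some 2, some 2] : Fin 4 → Option (Fin 4)) (n a) =
        (![some 0, some 0, some 2, some 2] : Fin 4 → Option (Fin 4)) a}
      one_mem' := fun _ => rfl
      mul_mem' := fun hf hg a => (hf _).trans (hg a)
      inv_mem' := fun {f} hf a => by rw [← hf, perm_apply_inv] }
  conj_mem f hf n hn a := by
    have h := (hf (n (f⁻¹ a)) (f⁻¹ a)).mpr (hn _)
    rwa [perm_apply_inv] at h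

end FiberDatum

/-! ### Examples with explicit labels -/

open FiberDatum

theorem exists_locallyIntransitive_inversion :
    ∃ d : ℕ, 3 ≤ d ∧ ∃ H : Subgroup (GraphAut (regularTree d)),
      IsUniversalIntersection H ∧ IsClosedNondiscreteCompGen H ∧ LocallyIntransitive H ∧
        ∃ h ∈ quasiCenter H, IsInversion (h : GraphAut (regularTree d)) := by
  let D : FiberDatum 4 := deletion {0}
  refine ⟨4, by norm_num, D.group, D.isUniversalIntersection_group,
    isClosedNondiscreteCompGen_group (deletion_not_discreteTopology (i := 1) (a := 2) (b := 3)
      (by decide) (by decide) (by decide) (by decide) (by decide) (by decide)),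
    deletion_locallyIntransitive (a := 0) (b := 1) (by decide) (by decide),
    ⟨labelAut (treeGen 0), D.labelAut_mem_group _⟩, ?_, isInversion_labelAut_treeGen 0⟩
  refine D.isStabilizerFull_group.mem_quasiCenter _ (one_mem _) (fun _ => rfl) ?_
    fun x => locPerm_labelAut _ x
  change D.proj (labelAut (treeGen 0) 1) = 1
  rw [labelAut_apply, treeGen_inv, mul_one]
  exact D.proj_treeGen_of_none (deletion_rep_of_mem (by decide))

theorem exists_locallyIntransitive_hyperbolic :
    ∃ d : ℕ, 3 ≤ d ∧ ∃ H : Subgroup (GraphAut (regularTree d)),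
      IsUniversalIntersection H ∧ IsClosedNondiscreteCompGen H ∧ LocallyIntransitive H ∧
        ∃ h ∈ quasiCenter H, IsHyperbolic (h : GraphAut (regularTree d)) ∧
          translationLength (h : GraphAut (regularTree d)) = 1 := by
  let D : FiberDatum 5 := deletion {0, 1}
  have hτF : Equiv.swap 0 1 ∈ D.F := by
    change ∀ a : Fin 5, Equiv.swap 0 1 a ∈ ({0, 1} : Finset (Fin 5)) ↔ a ∈ ({0, 1} : Finset _)
    decide
  have hrep : ∀ a, D.rep (Equiv.swap 0 1 a) = D.rep a := by
    change ∀ a : Fin 5, (if Equiv.swap 0 1 a ∈ ({0, 1} : Finset (Fin 5)) then none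
      else some (Equiv.swap 0 1 a)) = if a ∈ ({0, 1} : Finset (Fin 5)) then none else some a
    decide
  -- The local permutations preserve {0, 1}, so they commute with its transposition.
  have hτN : Equiv.swap 0 1 ∈ D.N := by
    refine Subgroup.mem_centralizer_iff.mpr fun f hf => ?_
    have h0 : f 0 = 0 ∨ f 0 = 1 := by simpa using (hf 0).mpr (by decide)
    have h1 : f 1 = 0 ∨ f 1 = 1 := by simpa using (hf 1).mpr (by decide)
    have h01 : f 0 ≠ f 1 := f.injective.ne (by decide)
    rw [Equiv.mul_swap_eq_swap_mul]
    congr 1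
    rcases h0 with h0 | h0 <;> rcases h1 with h1 | h1 <;> rw [h0, h1] at h01 ⊢
    · exact absurd rfl h01
    · exact Equiv.swap_comm _ _
    · exact absurd rfl h01
  obtain ⟨h, hh, hh1, hhτ⟩ := D.exists_mem_group_affine hτF (treeGen 0)
  refine ⟨5, by norm_num, D.group, D.isUniversalIntersection_group,
    isClosedNondiscreteCompGen_group (deletion_not_discreteTopology (i := 2) (a := 3) (b := 4)
      (by decide) (by decide) (by decide) (by decide) (by decide) (by decide)),
    deletion_locallyIntransitive (a := 0) (b := 2) (by decide) (by decide),
    ⟨h, hh⟩, D.isStabilizerFull_group.mem_quasiCenter _ hτN hrep ?_ hhτ,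
    isHyperbolic_of_affine (a := 0) (b := 1) (by decide) (Equiv.swap_apply_left _ _)
      (Equiv.swap_apply_right _ _) hh1 hhτ⟩
  change D.proj (h 1) = 1
  rw [hh1]
  exact D.proj_treeGen_of_none (deletion_rep_of_mem (by decide))

theorem exists_locallyTransitive_edgeFixating :
    ∃ d : ℕ, 3 ≤ d ∧ ∃ H : Subgroup (GraphAut (regularTree d)),
      IsUniversalIntersection H ∧ IsClosedNondiscreteCompGen H ∧ LocallyTransitive H ∧
        ∃ h ∈ quasiCenter H, h ≠ 1 ∧ IsEdgeFixating (h : GraphAut (regularTree d)) := by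
  let D : FiberDatum 4 := pairing
  have hF : Equiv.swap 0 1 ∈ D.F := by
    change ∀ a b : Fin 4, _ ↔ _
    decide
  have hN : Equiv.swap 0 1 ∈ D.N := by
    change ∀ a : Fin 4, _ = _
    decide
  -- Here the transposition is not central in F, but N is the Klein four-group generated by the
  -- transpositions of the two pairs, hence abelian.
  have hcomm : ∀ n ∈ D.N, Equiv.swap 0 1 * n = n * Equiv.swap 0 1 := by
    change ∀ n : Equiv.Perm (Fin 4),
      (∀ a, (![some 0, some 0, some 2, some 2] : Fin 4 → Option (Fin 4)) (n a) =
        (![some 0, some 0, some 2, some 2] : Fin 4 → Option (Fin 4)) a) → _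
    decide
  have htrans : ∀ a b, ∃ f ∈ D.F, f a = b := by
    have h1 : ∀ a b : Fin 4, ∃ f ∈ ({1, Equiv.swap 0 1, Equiv.swap 2 3,
        Equiv.swap 0 2 * Equiv.swap 1 3, Equiv.swap 0 3 * Equiv.swap 1 2} :
        Finset (Equiv.Perm (Fin 4))), f a = b := by
      decide
    have h2 : ∀ f ∈ ({1, Equiv.swap 0 1, Equiv.swap 2 3,
        Equiv.swap 0 2 * Equiv.swap 1 3, Equiv.swap 0 3 * Equiv.swap 1 2} :
        Finset (Equiv.Perm (Fin 4))), ∀ a b,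
        (![some 0, some 0, some 2, some 2] : Fin 4 → Option (Fin 4)) (f a) =
        (![some 0, some 0, some 2, some 2] : Fin 4 → Option (Fin 4)) (f b) ↔
        (![some 0, some 0, some 2, some 2] : Fin 4 → Option (Fin 4)) a =
        (![some 0, some 0, some 2, some 2] : Fin 4 → Option (Fin 4)) b := by
      decide
    intro a b
    obtain ⟨f, hf, h⟩ := h1 a b
    exact ⟨f, h2 f hf, h⟩
  have hfix : ∀ a, D.rep a = some 2 → Equiv.swap 0 1 a = a := by
    decide
  have hne : (Equiv.swap 0 1 : Equiv.Perm (Fin 4)) ≠ 1 := by decide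
  obtain ⟨h, hh, hh1, hhf⟩ := D.exists_mem_group_const hF
  refine ⟨4, by norm_num, D.group, D.isUniversalIntersection_group,
    isClosedNondiscreteCompGen_group (D.isStabilizerFull_group.not_discreteTopology hF hne hcomm
      (i₀ := 2) (j := 0) rfl hfix rfl (by decide)),
    D.isStabilizerFull_group.locallyTransitive htrans, ⟨h, hh⟩,
    D.isStabilizerFull_group.mem_quasiCenter _ hN hN ?_ hhf, ?_, 1, treeGen 2, ?_, hh1, ?_⟩
  · change D.proj (h 1) = 1
    rw [hh1, map_one]
  · intro h1
    have h2 : h = 1 := congrArg Subtype.val h1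
    refine hne ?_
    rw [← hhf 1, h2, locPerm_one]
  · have := adj_one_treeGen 1 (2 : Fin 4)
    rwa [one_mul] at this
  · have := apply_mul_treeGen h 1 2
    rw [one_mul, hh1, one_mul, hhf] at this
    exact this

/-! ### Examples from finite permutation groups with a non-trivial centralizer -/

theorem three_le_of_centralizing {d : ℕ} {τ f : Equiv.Perm (Fin d)} (hcomm : Commute f τ)
    {a b : Fin d} (ha : f a = a) (hb : f b ≠ b) (hτ : τ a ≠ a) : 3 ≤ d := by
  have h1 : b ≠ a := fun h => hb (h ▸ ha)
  have h2 : b ≠ τ a := by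
    rintro rfl
    refine hb ?_
    rw [← Equiv.Perm.mul_apply, hcomm.eq, Equiv.Perm.mul_apply, ha]
  -- Commutation makes f fix τ a as well as a, while it moves b.
  have h3 : ({b, τ a, a} : Finset (Fin d)).card = 3 := by
    rw [Finset.card_eq_three]
    exact ⟨b, τ a, a, h2, h1, hτ, rfl⟩
  rw [← h3]
  exact (Finset.card_le_univ _).trans_eq (Fintype.card_fin d)

section Action

variable {G Ω : Type*} [Group G] [MulAction G Ω]

/-- The action on a set as permutations of the labels. -/
noncomputable def labelAction {d : ℕ} (e : Ω ≃ Fin d) : G →* Equiv.Perm (Fin d) :=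
  e.permCongrHom.toMonoidHom.comp (MulAction.toPermHom G Ω)

theorem labelAction_apply {d : ℕ} (e : Ω ≃ Fin d) (g : G) (ω : Ω) :
    labelAction e g (e ω) = e (g • ω) := by
  simp [labelAction, Equiv.permCongrHom]

theorem permCongr_apply_apply {d : ℕ} (e : Ω ≃ Fin d) (τ : Equiv.Perm Ω) (ω : Ω) :
    e.permCongr τ (e ω) = e (τ ω) := by
  simp

theorem labelAction_commute {d : ℕ} (e : Ω ≃ Fin d) {τ : Equiv.Perm Ω}
    (hτ : ∀ (g : G) ω, g • τ ω = τ (g • ω)) :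
    ∀ f ∈ (labelAction e : G →* _).range, Commute f (e.permCongr τ) := by
  rintro _ ⟨g, rfl⟩
  refine Equiv.ext fun a => ?_
  obtain ⟨ω, rfl⟩ := e.surjective a
  rw [Equiv.Perm.mul_apply, Equiv.Perm.mul_apply, permCongr_apply_apply, labelAction_apply,
    labelAction_apply, permCongr_apply_apply, hτ]

theorem labelAction_pretransitive [MulAction.IsPretransitive G Ω] {d : ℕ} (e : Ω ≃ Fin d) {X : Type*}
    (e' : Fin d ≃ X) (x y : X) :
    ∃ g : G, e'.permCongrHom.toMonoidHom.comp (labelAction e) g x = y := by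
  obtain ⟨a, rfl⟩ := e'.surjective x
  obtain ⟨b, rfl⟩ := e'.surjective y
  obtain ⟨ω, rfl⟩ := e.surjective a
  obtain ⟨ω', rfl⟩ := e.surjective b
  obtain ⟨g, hg⟩ := MulAction.exists_smul_eq G ω ω'
  refine ⟨g, ?_⟩
  have : e'.permCongrHom.toMonoidHom.comp (labelAction e) g (e' (e ω)) =
      e' (labelAction e g (e ω)) := by
    simp [Equiv.permCongrHom]
  rw [this, labelAction_apply, hg]

theorem labelAction_range_map {d : ℕ} (e : Ω ≃ Fin d) {X : Type*} (e' : Fin d ≃ X) :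
    (labelAction e : G →* _).range.map e'.permCongrHom.toMonoidHom =
      (e'.permCongrHom.toMonoidHom.comp (labelAction e : G →* _)).range :=
  MonoidHom.map_range _ _

/-- The labels of ω₀ and τ ω₀ have the same projection, so the product of their generators lies in
the kernel of `proj`. The resulting label-respecting translation is quasi-central even if τ is not
induced by G. -/
theorem exists_hyperbolic_of_isSimpleGroup [IsSimpleGroup G] [Finite Ω]
    (htrans : MulAction.IsPretransitive G Ω) (τ : Equiv.Perm Ω) (hτ : ∀ (g : G) ω, g • τ ω = τ (g • ω))
    (f : G) {ω₀ ω₁ : Ω} (h₀ : f • ω₀ = ω₀) (h₁ : f • ω₁ ≠ ω₁) (hτ₀ : τ ω₀ ≠ ω₀) :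
    ∃ d : ℕ, 3 ≤ d ∧ ∃ H : Subgroup (GraphAut (regularTree d)),
      IsBipartiteUniversalIntersection H ∧ IsClosedNondiscreteCompGen H ∧
        LocallyQuasiprimitive H ∧
        ∃ h ∈ quasiCenter H, IsHyperbolic (h : GraphAut (regularTree d)) ∧
          translationLength (h : GraphAut (regularTree d)) = 2 := by
  let e : Ω ≃ Fin (Nat.card Ω) := Finite.equivFin Ω
  let D := ofCentralizing (e.permCongr τ) (labelAction e : G →* _).range (labelAction_commute e hτ)
  have hfF : labelAction e f ∈ (labelAction e : G →* _).range := ⟨f, rfl⟩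
  have hf₀ : labelAction e f (e ω₀) = e ω₀ := by rw [labelAction_apply, h₀]
  have hf₁ : labelAction e f (e ω₁) ≠ e ω₁ := by
    rw [labelAction_apply]
    exact e.injective.ne h₁
  have hτe : e.permCongr τ (e ω₀) ≠ e ω₀ := by
    rw [permCongr_apply_apply]
    exact e.injective.ne hτ₀
  have hH := D.isStabilizerFull_inf_bipartiteAut
  have hlab : labelAut (treeGen (e.permCongr τ (e ω₀)) * treeGen (e ω₀)) ∈
      D.group ⊓ bipartiteAut _ := by
    refine D.labelAut_mem_inf_bipartiteAut ?_
    rw [map_mul, treeParity_treeGen, treeParity_treeGen]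
    decide
  refine ⟨_, three_le_of_centralizing (labelAction_commute e hτ _ hfF) hf₀ hf₁ hτe,
    D.group ⊓ bipartiteAut _, D.isBipartiteUniversalIntersection_inf_bipartiteAut,
    isClosedNondiscreteCompGen_inf_bipartiteAut
      (ofCentralizing_not_discreteTopology hfF hf₀ hf₁ hH), fun x => ?_,
    ⟨_, hlab⟩, hH.mem_quasiCenter _ (one_mem _) (fun _ => rfl) ?_ fun x => locPerm_labelAut _ x,
    isHyperbolic_labelAut hτe⟩
  · rw [hH.localAction_eq]
    change IsQuasiprimitivePerm ((labelAction e : G →* _).range.map _)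
    rw [labelAction_range_map]
    exact isQuasiprimitivePerm_range _ (labelAction_pretransitive (G := G) e _)
  · change D.proj (labelAut _ 1) = 1
    rw [labelAut_apply, mul_one, mul_inv_rev, treeGen_inv, treeGen_inv, map_mul,
      D.proj_treeGen_congr (ofCentralizing_rep_apply (e ω₀)), ← map_mul, treeGen_mul_self, map_one]

/-- The permutation induced by z lies in the local action and also centralizes it, so the
automorphism fixing 1 with this constant local permutation belongs to the group and is
quasi-central. -/
theorem exists_elliptic_of_central [Finite Ω] [MulAction.IsPretransitive G Ω] (z : G)
    (hz : ∀ g, g * z = z * g) (f : G) {ω₀ ω₁ : Ω} (h₀ : f • ω₀ = ω₀) (h₁ : f • ω₁ ≠ ω₁)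
    (hz₀ : z • ω₀ ≠ ω₀)
    (hnormal : ∀ g : G, g ≠ 1 → ∀ ω : Ω, g • ω = ω → Subgroup.normalClosure {g} = ⊤) :
    ∃ d : ℕ, 3 ≤ d ∧ ∃ H : Subgroup (GraphAut (regularTree d)),
      IsUniversalIntersection H ∧ IsClosedNondiscreteCompGen H ∧ LocallySemiprimitive H ∧
        ∃ h ∈ quasiCenter H, h ≠ 1 ∧ IsElliptic (h : GraphAut (regularTree d)) := by
  let e : Ω ≃ Fin (Nat.card Ω) := Finite.equivFin Ω
  have hτ : ∀ (g : G) (ω : Ω), g • MulAction.toPerm z ω = MulAction.toPerm z (g • ω) :=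
    fun g ω => by
      rw [MulAction.toPerm_apply, MulAction.toPerm_apply, smul_smul, smul_smul, hz]
  let D := ofCentralizing (e.permCongr (MulAction.toPerm z)) (labelAction e : G →* _).range
    (labelAction_commute e hτ)
  have hfF : labelAction e f ∈ (labelAction e : G →* _).range := ⟨f, rfl⟩
  have hf₀ : labelAction e f (e ω₀) = e ω₀ := by rw [labelAction_apply, h₀]
  have hf₁ : labelAction e f (e ω₁) ≠ e ω₁ := by
    rw [labelAction_apply]
    exact e.injective.ne h₁
  have hτe : e.permCongr (MulAction.toPerm z) (e ω₀) ≠ e ω₀ := by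
    rw [permCongr_apply_apply]
    exact e.injective.ne hz₀
  have hH := D.isStabilizerFull_group
  have hτF : e.permCongr (MulAction.toPerm z) ∈ D.F := ⟨z, rfl⟩
  have hτN : e.permCongr (MulAction.toPerm z) ∈ D.N :=
    Subgroup.mem_centralizer_iff.mpr fun f hf => labelAction_commute e hτ f hf
  obtain ⟨h, hh, hh1, hhτ⟩ := D.exists_mem_group_const hτF
  refine ⟨_, three_le_of_centralizing (labelAction_commute e hτ _ hfF) hf₀ hf₁ hτe,
    D.group, D.isUniversalIntersection_group, isClosedNondiscreteCompGen_group
      (ofCentralizing_not_discreteTopology hfF hf₀ hf₁ hH), fun x => ?_,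
    ⟨h, hh⟩, hH.mem_quasiCenter _ hτN ofCentralizing_rep_apply ?_ hhτ, ?_,
    isElliptic_of_apply_eq hh1⟩
  · rw [hH.localAction_eq]
    change IsSemiprimitivePerm ((labelAction e : G →* _).range.map _)
    rw [labelAction_range_map]
    refine isSemiprimitivePerm_range _ (labelAction_pretransitive (G := G) e _) ?_
    rintro g hg ⟨y, hy⟩
    obtain ⟨a, rfl⟩ := (neighborEquiv _ x).surjective y
    obtain ⟨ω, rfl⟩ := e.surjective a
    have hy' : (neighborEquiv _ x).permCongrHom.toMonoidHom.comp (labelAction e) g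
        (neighborEquiv _ x (e ω)) = neighborEquiv _ x (labelAction e g (e ω)) := by
      simp [Equiv.permCongrHom]
    rw [hy', labelAction_apply, EmbeddingLike.apply_eq_iff_eq, EmbeddingLike.apply_eq_iff_eq] at hy
    refine hnormal g ?_ ω hy
    rintro rfl
    exact hg (map_one _)
  · change D.proj (h 1) = 1
    rw [hh1, map_one]
  · intro h1
    have h2 : h = 1 := congrArg Subtype.val h1
    have h3 := hhτ 1
    rw [h2, locPerm_one] at h3
    exact hτe (by rw [← h3, Equiv.Perm.one_apply])

end Action

theorem exists_locallyQuasiprimitive_hyperbolic :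
    ∃ d : ℕ, 3 ≤ d ∧ ∃ H : Subgroup (GraphAut (regularTree d)),
      IsBipartiteUniversalIntersection H ∧ IsClosedNondiscreteCompGen H ∧
        LocallyQuasiprimitive H ∧
        ∃ h ∈ quasiCenter H, IsHyperbolic (h : GraphAut (regularTree d)) ∧
          translationLength (h : GraphAut (regularTree d)) = 2 := by
  have h3 : MulAction.IsMultiplyPretransitive (alternatingGroup (Fin 5)) (Fin 5) 3 := by
    have := alternatingGroup.isMultiplyPretransitive (Fin 5)
    rwa [Nat.card_eq_fintype_card, Fintype.card_fin] at this
  have h2 : MulAction.IsPretransitive (alternatingGroup (Fin 5)) (Fin 2 ↪ Fin 5) :=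
    MulAction.isMultiplyPretransitive_of_le (m := 2) (n := 3) (by norm_num) (by simp)
  have hf : Equiv.swap (0 : Fin 5) 1 * Equiv.swap 1 2 ∈ alternatingGroup (Fin 5) := by
    rw [Equiv.Perm.mem_alternatingGroup]
    decide
  -- The 3-cycle on 0, 1, 2 fixes the ordered pair (3, 4) and moves (0, 1); exchanging coordinates
  -- commutes with the action and fixes no pair.
  refine exists_hyperbolic_of_isSimpleGroup (G := alternatingGroup (Fin 5)) (Ω := Fin 2 ↪ Fin 5) h2
    (Equiv.embeddingCongr (Equiv.swap 0 1) (Equiv.refl _)) (fun g ω => rfl) ⟨_, hf⟩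
    (ω₀ := ⟨![3, 4], by decide⟩) (ω₁ := ⟨![0, 1], by decide⟩) ?_ ?_ ?_
  · ext i
    fin_cases i <;> rfl
  · intro h
    exact absurd (show (Equiv.swap 0 1 * Equiv.swap 1 2 : Equiv.Perm (Fin 5)) 0 = 0 from
      DFunLike.congr_fun h 0) (by decide)
  · intro h
    exact absurd (DFunLike.congr_fun h 0) (by decide)

/-! ### The group `SL(2, 3)` -/

section SpecialLinear

open Matrix

/-- The upper unitriangular matrices. -/
def upperUnipotent : Multiplicative (ZMod 3) →* SpecialLinearGroup (Fin 2) (ZMod 3) where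
  toFun x := ⟨!![1, x.toAdd; 0, 1], by simp⟩
  map_one' := by
    ext i j
    fin_cases i <;> fin_cases j <;> rfl
  map_mul' := by
    have h : ∀ x y : Multiplicative (ZMod 3), !![1, (x * y).toAdd; 0, 1] =
      !![1, x.toAdd; 0, 1] * !![1, y.toAdd; 0, 1] := by decide
    exact fun x y => Subtype.ext (h x y)

/-- The Weyl element. -/
def weylElement : SpecialLinearGroup (Fin 2) (ZMod 3) := ⟨!![0, 1; -1, 0], by decide⟩

theorem specialLinear_eq_mul (g : SpecialLinearGroup (Fin 2) (ZMod 3)) : ∃ a b c e,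
    g = upperUnipotent a * (weylElement * upperUnipotent b * weylElement⁻¹) * upperUnipotent c *
      (weylElement * upperUnipotent e * weylElement⁻¹) := by
  revert g
  decide

/-- The unitriangular group has prime order 3, so one non-trivial element yields all of it; its Weyl
conjugate is the lower one, and the two generate SL(2,3). -/
theorem eq_top_of_upperUnipotent_mem {x : Multiplicative (ZMod 3)} (hx : x ≠ 1)
    (M : Subgroup (SpecialLinearGroup (Fin 2) (ZMod 3))) [hM : M.Normal]
    (h : upperUnipotent x ∈ M) : M = ⊤ := by
  have hpow : ∀ x : Multiplicative (ZMod 3), x ≠ 1 → ∀ y, ∃ k : Fin 3, y = x ^ (k : ℕ) := by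
    decide
  have hU : ∀ y, upperUnipotent y ∈ M := fun y => by
    obtain ⟨k, rfl⟩ := hpow x hx y
    rw [map_pow]
    exact pow_mem h _
  have hL : ∀ y, weylElement * upperUnipotent y * weylElement⁻¹ ∈ M := fun y =>
    hM.conj_mem _ (hU y) weylElement
  rw [eq_top_iff]
  intro g _
  obtain ⟨a, b, c, e, rfl⟩ := specialLinear_eq_mul g
  exact mul_mem (mul_mem (mul_mem (hU a) (hL b)) (hU c)) (hL e)

end SpecialLinear

theorem exists_locallySemiprimitive_elliptic :
    ∃ d : ℕ, 3 ≤ d ∧ ∃ H : Subgroup (GraphAut (regularTree d)),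
      IsUniversalIntersection H ∧ IsClosedNondiscreteCompGen H ∧ LocallySemiprimitive H ∧
        ∃ h ∈ quasiCenter H, h ≠ 1 ∧ IsElliptic (h : GraphAut (regularTree d)) := by
  have hmem : ∀ g ∈ upperUnipotent.range, g.1 0 0 = 1 ∧ g.1 1 0 = 0 := by
    rintro _ ⟨x, rfl⟩
    exact ⟨rfl, rfl⟩
  -- Point stabilizers are the conjugates of the unitriangular group, which does not contain -1. A
  -- non-trivial element with a fixed point is thus conjugate to a non-trivial unitriangular matrix
  -- and has full normal closure.
  refine exists_elliptic_of_central
    (Ω := Matrix.SpecialLinearGroup (Fin 2) (ZMod 3) ⧸ upperUnipotent.range) (-1)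
    (fun g => by simp) (upperUnipotent (Multiplicative.ofAdd 1))
    (ω₀ := QuotientGroup.mk 1) (ω₁ := QuotientGroup.mk weylElement) ?_ ?_ ?_ ?_
  · refine QuotientGroup.eq.mpr ?_
    simp only [smul_eq_mul, mul_one]
    exact inv_mem ⟨_, rfl⟩
  · intro h
    exact absurd (hmem _ (QuotientGroup.eq.mp h)).2 (by decide)
  · intro h
    exact absurd (hmem _ (QuotientGroup.eq.mp h)).1 (by decide)
  · intro g hg ω hω
    obtain ⟨b, rfl⟩ := QuotientGroup.mk_surjective ω
    obtain ⟨u, hu⟩ : b⁻¹ * g⁻¹ * b ∈ upperUnipotent.range := by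
      have := QuotientGroup.eq.mp hω
      simpa only [smul_eq_mul, mul_inv_rev] using this
    refine eq_top_of_upperUnipotent_mem (x := u) ?_ _ ?_
    · rintro rfl
      rw [map_one] at hu
      refine hg (inv_eq_one.mp ?_)
      calc g⁻¹ = b * (b⁻¹ * g⁻¹ * b) * b⁻¹ := by group
        _ = 1 := by rw [← hu, mul_one, mul_inv_cancel]
    · rw [hu]
      have h1 : g⁻¹ ∈ Subgroup.normalClosure {g} :=
        inv_mem (Subgroup.subset_normalClosure rfl)
      have := Subgroup.normalClosure_normal.conj_mem _ h1 b⁻¹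
      rwa [inv_inv] at this

theorem mainTheorem4 :
    (∃ d : ℕ, 3 ≤ d ∧ ∃ H : Subgroup (GraphAut (regularTree d)),
      IsUniversalIntersection H ∧ IsClosedNondiscreteCompGen H ∧ LocallyIntransitive H ∧
        ∃ h ∈ quasiCenter H, IsInversion (h : GraphAut (regularTree d))) ∧
    (∃ d : ℕ, 3 ≤ d ∧ ∃ H : Subgroup (GraphAut (regularTree d)),
      IsUniversalIntersection H ∧ IsClosedNondiscreteCompGen H ∧ LocallyTransitive H ∧
        ∃ h ∈ quasiCenter H, h ≠ 1 ∧ IsEdgeFixating (h : GraphAut (regularTree d))) ∧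
    (∃ d : ℕ, 3 ≤ d ∧ ∃ H : Subgroup (GraphAut (regularTree d)),
      IsUniversalIntersection H ∧ IsClosedNondiscreteCompGen H ∧ LocallySemiprimitive H ∧
        ∃ h ∈ quasiCenter H, h ≠ 1 ∧ IsElliptic (h : GraphAut (regularTree d))) ∧
    (∃ d : ℕ, 3 ≤ d ∧ ∃ H : Subgroup (GraphAut (regularTree d)),
      IsUniversalIntersection H ∧ IsClosedNondiscreteCompGen H ∧ LocallyIntransitive H ∧
        ∃ h ∈ quasiCenter H, IsHyperbolic (h : GraphAut (regularTree d)) ∧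
          translationLength (h : GraphAut (regularTree d)) = 1) ∧
    (∃ d : ℕ, 3 ≤ d ∧ ∃ H : Subgroup (GraphAut (regularTree d)),
      IsBipartiteUniversalIntersection H ∧ IsClosedNondiscreteCompGen H ∧
        LocallyQuasiprimitive H ∧
        ∃ h ∈ quasiCenter H, IsHyperbolic (h : GraphAut (regularTree d)) ∧
          translationLength (h : GraphAut (regularTree d)) = 2) := by
  exact ⟨exists_locallyIntransitive_inversion, exists_locallyTransitive_edgeFixating,
    exists_locallySemiprimitive_elliptic, exists_locallyIntransitive_hyperbolic,
    exists_locallyQuasiprimitive_hyperbolic⟩
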